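/- An instance $\mathcal A=(G,I_{\mathsf{init}},I_{\mathsf{fin}},k)$ of TJ- or TS-Independent Set Reconfiguration consists of a finite graph $G=(V,E)$ and two independent sets $I_{\mathsf{init}},I_{\mathsf{fin}}$ of size $k$ (the number of tokens, which is the parameter). A reconfiguration sequence of length $\ell$ is a sequence $I_{\mathsf{init}}=I_0,I_1,\dots,I_\ell=I_{\mathsf{fin}}$ of independent sets of size $k$ in which each $I_{t+1}$ arises from $I_t$ by moving exactly one token from its vertex $u$ to a vertex $v\notin I_t$; for token jumping (TJ) $v$ is arbitrary, for token sliding (TS) $v$ must be adjacent to $u$. The question is whether a reconfiguration sequence exists. A pl-reduction (parameterized logspace reduction) is a map on instances that preserves yes- and no-instances, bounds the new parameter by a computable function of the old one, and is computable by a deterministic algorithm in space $O(g(k)+\log N)$, where $N$ is the length of the encoded instance and $g$ is a computable function. For $\mathcal A=(G,I_{\mathsf{init}},I_{\mathsf{fin}},k)$ let $G''$ be the following graph. Its vertices are $v^i$ ($v\in V$, $i\in[1,k]$), $f^1,\dots,f^k$, $z_{\mathsf{init}}$ and $z_{\mathsf{fin}}$. Each $V^i=\{v^i:v\in V\}$ is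 a clique; for $i\ne j$, $v^iw^j$ is an edge iff $v=w$ or $vw\in E$; and the remaining edges are $f^iv^i$ and $f^iz_{\mathsf{init}}$ ($v\in V$, $i\in[1,k]$), $v^iz_{\mathsf{fin}}$ ($v\in V\setminus I_{\mathsf{fin}}$, $i\in[1,k]$), and $z_{\mathsf{init}}z_{\mathsf{fin}}$. **Lemma.** There is a pl-reduction $f$ from TJ-Independent Set Reconfiguration to TS-Independent Set Reconfiguration such that, for every instance $\mathcal A=(G,I_{\mathsf{init}},I_{\mathsf{fin}},k)$: 1. up to the names of the vertices, $f(\mathcal A)=(G'',\{s_1^1,\dots,s_k^k,z_{\mathsf{init}}\},\{f^1,\dots,f^k,z_{\mathsf{fin}}\},k+1)$ for some ordering $s_1,\dots,s_k$ of $I_{\mathsf{init}}$; 2. for every integer $\ell\ge 0$, $\mathcal A$ admits a TJ reconfiguration sequence of length at most $\ell$ if and only if $f(\mathcal A)$ admits a TS reconfiguration sequence of length at most $\ell+k+1$; 3. for every integer $\ell\ge 0$, if $\mathcal A$ admits a TJ reconfiguration sequence of length exactly $\ell$, then $f(\mathcal A)$ admits a TS reconfiguration sequence of length exactly $\ell+k+1$.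 -/

import Mathlib

/-! ### Space-bounded computation: deterministic Turing machines with a read-only input tape,
finitely many work tapes and a write-only output tape -/

/-- Head movements. -/
inductive HeadMove where
  | left
  | stay
  | right

/-- What the input head sees: an end marker or a bit of the input. -/
inductive InputSymbol where
  | leftEnd
  | bit (b : Bool)
  | rightEnd

/-- What a machine does in one step, for state set `Q`, work alphabet `Γ` and `t` work tapes:
go to a new state, move the input head, write a symbol on each work tape, move the work heads, and
possibly append one bit to the output. -/
structure MachineAction (Q Γ : Type) (t : ℕ) where
  next : Q
  inputMove : HeadMove
  write : Fin t → Γ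
  workMove : Fin t → HeadMove
  emit : Option Bool

/-- A deterministic Turing machine transducer: a finite set of states, a finite work alphabet with
a blank, a number of work tapes, and a transition function (value `none` means that the machine
halts). -/
structure Transducer where
  State : Type
  finiteState : Finite State
  Symbol : Type
  finiteSymbol : Finite Symbol
  blank : Symbol
  tapes : ℕ
  start : State
  trans : State → InputSymbol → (Fin tapes → Symbol) → Option (MachineAction State Symbol tapes)

namespace Transducer

/-- The symbol at position `p` of the input tape `⊢ x₀ x₁ … x_{n-1} ⊣`. -/
def inputAt (x : List Bool) : ℕ → InputSymbol
  | 0 => .leftEnd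
  | p + 1 =>
    match x[p]? with
    | some b => .bit b
    | none => .rightEnd

/-- The input head never leaves the segment between the two end markers. -/
def moveInput (x : List Bool) (p : ℕ) : HeadMove → ℕ
  | .left => p - 1
  | .stay => p
  | .right => min (p + 1) (x.length + 1)

/-- Work tapes are infinite to the right only; a left move on the first cell has no effect. -/
def moveWork (p : ℕ) : HeadMove → ℕ
  | .left => p - 1
  | .stay => p
  | .right => p + 1

/-- Configurations of `M` (the input is kept separately, as it never changes). -/
structure Config (M : Transducer) where
  state : M.State
  inputHead : ℕ
  work : Fin M.tapes → ℕ → M.Symbol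
  head : Fin M.tapes → ℕ
  output : List Bool

/-- The start configuration: all heads on the first cell, blank work tapes, empty output. -/
def initial (M : Transducer) : M.Config where
  state := M.start
  inputHead := 0
  work := fun _ _ => M.blank
  head := fun _ => 0
  output := []

/-- One step of `M` on input `x`; `none` if `M` halts. -/
def step (M : Transducer) (x : List Bool) (c : M.Config) : Option M.Config :=
  (M.trans c.state (inputAt x c.inputHead) (fun i => c.work i (c.head i))).map fun a =>
    { state := a.next
      inputHead := moveInput x c.inputHead a.inputMove
      work := fun i => Function.update (c.work i) (c.head i) (a.write i)
      head := fun i => moveWork (c.head i) (a.workMove i)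
      output := c.output ++ a.emit.toList }

/-- The configurations that occur in the run of `M` on input `x`. -/
def Reaches (M : Transducer) (x : List Bool) (c : M.Config) : Prop :=
  Relation.ReflTransGen (fun c₁ c₂ => M.step x c₁ = some c₂) M.initial c

/-- On input `x` the machine halts with output `y`, and during the run it visits no work-tape cell
beyond the first `s` cells of each (of its constantly many) work tapes. The input and output tapes
are not counted. -/
def ComputesInSpace (M : Transducer) (x y : List Bool) (s : ℕ) : Prop :=
  (∃ c, M.Reaches x c ∧ M.step x c = none ∧ c.output = y) ∧
    ∀ c, M.Reaches x c → ∀ i, c.head i < s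

end Transducer

/-! ### Parameterized problems and parameterized logspace reductions -/

/-- A parameterized decision problem: instances with their encoding as bit strings, the parameter
of an instance, and the yes-instances. -/
structure ParamProblem where
  Instance : Type
  encode : Instance → List Bool
  param : Instance → ℕ
  Yes : Instance → Prop

/-- `f` is a parameterized logspace reduction (pl-reduction) from `P` to `Q`: it preserves the
answer, the new parameter is bounded by a computable function of the old one, and `f` is computed
by a deterministic machine in space `O(g(k) + log n)`, where `k` is the parameter, `n` the length
of the encoded instance, and `g` is computable. -/
def IsPLReduction (P Q : ParamProblem) (f : P.Instance → Q.Instance) : Prop :=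
  (∀ a, P.Yes a ↔ Q.Yes (f a)) ∧
  (∃ h : ℕ → ℕ, Computable h ∧ ∀ a, Q.param (f a) ≤ h (P.param a)) ∧
  ∃ (M : Transducer) (g : ℕ → ℕ) (C : ℕ), Computable g ∧
    ∀ a, M.ComputesInSpace (P.encode a) (Q.encode (f a))
      (C * (g (P.param a) + Nat.log 2 (P.encode a).length))

/-! ### Independent set reconfiguration -/

/-- An instance `(G, I_init, I_fin, k)`: a finite graph and two independent sets of size `k`. -/
structure ISRInstance where
  n : ℕ
  graph : SimpleGraph (Fin n)
  init : Finset (Fin n)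
  fin : Finset (Fin n)
  k : ℕ
  init_indep : graph.IsIndepSet (init : Set (Fin n))
  fin_indep : graph.IsIndepSet (fin : Set (Fin n))
  init_card : init.card = k
  fin_card : fin.card = k

/-- A token jump: one token moves from its vertex `u` to some empty vertex `v`. -/
def TokenJump {V : Type} [DecidableEq V] (_G : SimpleGraph V) (S T : Finset V) : Prop :=
  ∃ u ∈ S, ∃ v ∉ S, T = insert v (S.erase u)

/-- A token slide: one token moves from its vertex `u` to some empty vertex `v` adjacent to `u`. -/
def TokenSlide {V : Type} [DecidableEq V] (G : SimpleGraph V) (S T : Finset V) : Prop :=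
  ∃ u ∈ S, ∃ v ∉ S, G.Adj u v ∧ T = insert v (S.erase u)

namespace ISRInstance

/-- `A` admits a reconfiguration sequence `I_init = I₀, I₁, …, I_ℓ = I_fin` of length `ℓ` (with
exactly `ℓ` moves), each set being independent of size `k` and each step being allowed by `move`. -/
def HasSequence (A : ISRInstance)
    (move : SimpleGraph (Fin A.n) → Finset (Fin A.n) → Finset (Fin A.n) → Prop) (l : ℕ) : Prop :=
  ∃ I : ℕ → Finset (Fin A.n), I 0 = A.init ∧ I l = A.fin ∧
    (∀ t ≤ l, A.graph.IsIndepSet (I t : Set (Fin A.n)) ∧ (I t).card = A.k) ∧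
    ∀ t < l, move A.graph (I t) (I (t + 1))

/-- `A` admits a token jumping reconfiguration sequence of length `l`. -/
def HasTJSequence (A : ISRInstance) (l : ℕ) : Prop := A.HasSequence TokenJump l

/-- `A` admits a token sliding reconfiguration sequence of length `l`. -/
def HasTSSequence (A : ISRInstance) (l : ℕ) : Prop := A.HasSequence TokenSlide l

open Classical in
/-- The encoding of an instance: `1ⁿ 0`, the adjacency matrix row by row, the characteristic
vectors of the two independent sets, and `1ᵏ`. -/
noncomputable def encode (A : ISRInstance) : List Bool :=
  List.replicate A.n true ++ [false] ++
    ((List.finRange A.n).flatMap fun u =>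
      (List.finRange A.n).map fun v => decide (A.graph.Adj u v)) ++
    ((List.finRange A.n).map fun v => decide (v ∈ A.init)) ++
    ((List.finRange A.n).map fun v => decide (v ∈ A.fin)) ++
    List.replicate A.k true

end ISRInstance

/-- TJ-Independent Set Reconfiguration, parameterized by the number of tokens. -/
noncomputable def TJIndependentSetReconfiguration : ParamProblem where
  Instance := ISRInstance
  encode := ISRInstance.encode
  param := ISRInstance.k
  Yes := fun A => ∃ l, A.HasTJSequence l

/-- TS-Independent Set Reconfiguration, parameterized by the number of tokens. -/
noncomputable def TSIndependentSetReconfiguration : ParamProblem where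
  Instance := ISRInstance
  encode := ISRInstance.encode
  param := ISRInstance.k
  Yes := fun A => ∃ l, A.HasTSSequence l

/-! ### The graph with `k` clique copies of the vertex set -/

/-- The vertices `vⁱ` (written `copy i v`), `fⁱ`, `z_init` and `z_fin`. -/
inductive CopyVertex (V : Type) (k : ℕ) where
  | copy (i : Fin k) (v : V)
  | f (i : Fin k)
  | zInit
  | zFin

namespace ISRInstance

/-- Each edge listed in one direction. Pairs of equal vertices are discarded in `copyGraph`, so the
first line makes each copy of the vertex set a clique and joins `vⁱ` and `wʲ` for `i ≠ j` exactly
if `v = w` or `vw` is an edge. -/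
def copyRel (A : ISRInstance) : CopyVertex (Fin A.n) A.k → CopyVertex (Fin A.n) A.k → Prop
  | .copy i v, .copy j w => i = j ∨ v = w ∨ A.graph.Adj v w
  | .f i, .copy j _ => i = j
  | .f _, .zInit => True
  | .copy _ v, .zFin => v ∉ A.fin
  | .zInit, .zFin => True
  | _, _ => False

/-- The graph on the vertices `vⁱ`, `fⁱ`, `z_init`, `z_fin`. -/
def copyGraph (A : ISRInstance) : SimpleGraph (CopyVertex (Fin A.n) A.k) :=
  SimpleGraph.fromRel A.copyRel

/-- `B` is, up to the names of the vertices, the instance with graph `A.copyGraph`, initial set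
`{(s₁)¹, …, (s_k)ᵏ, z_init}` for some ordering `s₁, …, s_k` of the initial set of `A`, final set
`{f¹, …, fᵏ, z_fin}`, and `k + 1` tokens. -/
def IsCopyInstance (A B : ISRInstance) : Prop :=
  B.k = A.k + 1 ∧
  ∃ s : Fin A.k → Fin A.n, Function.Injective s ∧ Set.range s = (A.init : Set (Fin A.n)) ∧
    ∃ e : A.copyGraph ≃g B.graph,
      (∀ w, e w ∈ B.init ↔ w = .zInit ∨ ∃ i, w = .copy i (s i)) ∧
      (∀ w, e w ∈ B.fin ↔ w = .zFin ∨ ∃ i, w = .f i)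

end ISRInstance

/-!
The reduction sends `A` to the instance on its copy graph, with the vertices numbered clique by
clique and the initial tokens placed in increasing order.

*Lengths of sequences.* The copy graph is covered by `k + 1` cliques: for each `i` the vertices `vⁱ`
together with `fⁱ`, and `{z_init, z_fin}`. An independent set of `k + 1` vertices has exactly one
token in each. While `z_init` is occupied no `fⁱ` is, so the tokens are `(s₁)¹, …, (s_k)ᵏ, z_init`
where `s₁, …, s_k` is an ordering of an independent set of size `k` of the given graph
(`isTokenSet_tokens_copy_zInit_iff`, `exists_eq_tokens_of_zInit_mem`), and slides correspond to
jumps of that set. The token on `z_init` can only leave for `z_fin`, which requires that the other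
tokens are on copies of the final set; afterwards each of them has to make at least one slide to
reach the `fⁱ`, and one slide each is enough. This gives the `k + 1` additional moves
(`moveChain_slide_of_jump_fin`, `moveChain_jump_of_slide`).

*Logarithmic space.* A machine is built from fragments: elementary operations on counters, which are
kept in binary on the work tapes, and sequencing, case distinction and loops. The relation
`Fragment.Exec` says that a fragment takes one store (input position, counters, output) to another
within a given space, and it has a rule for each construct; `Fragment.Emits` is the special case in
which only the output changes. The program (`Fragment.emitInstance`) writes the encoding of the new
instance by nested loops over the vertices of the copy graph, and finds the bits it needs by moving
the input head to positions such as `n + 2 + v * n + w`. All counters stay at most `n`, so their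
binary representations fit into logarithmic space (`computesInSpace_copyMachine`).
-/

/-! ### Chains of moves -/

/-- `MoveChain R good l X Y`: one gets from `X` to `Y` by exactly `l` moves of type `R`, and all
positions on the way, both ends included, are `good`. -/
inductive MoveChain {α : Type} (R : α → α → Prop) (good : α → Prop) : ℕ → α → α → Prop
  | refl {X : α} : good X → MoveChain R good 0 X X
  | head {X Y Z : α} {l : ℕ} :
      good X → R X Y → MoveChain R good l Y Z → MoveChain R good (l + 1) X Z

namespace MoveChain

variable {α β : Type} {R : α → α → Prop} {good : α → Prop}

theorem good_left {l : ℕ} {X Y : α} (h : MoveChain R good l X Y) : good X := by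
  cases h <;> assumption

theorem trans {l m : ℕ} {X Y Z : α} (h : MoveChain R good l X Y) (h' : MoveChain R good m Y Z) :
    MoveChain R good (l + m) X Z := by
  induction h with
  | refl _ => simpa using h'
  | head hX hR _ ih => rw [Nat.add_right_comm]; exact .head hX hR (ih h')

theorem map {R' : β → β → Prop} {good' : β → Prop} (φ : α → β)
    (hR : ∀ X Y, R X Y → R' (φ X) (φ Y)) (hgood : ∀ X, good X → good' (φ X))
    {l : ℕ} {X Y : α} (h : MoveChain R good l X Y) : MoveChain R' good' l (φ X) (φ Y) := by
  induction h with
  | refl hX => exact .refl (hgood _ hX)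
  | head hX hXY _ ih => exact .head (hgood _ hX) (hR _ _ hXY) ih

theorem iff_exists_seq {l : ℕ} {X Y : α} :
    MoveChain R good l X Y ↔ ∃ I : ℕ → α, I 0 = X ∧ I l = Y ∧ (∀ t ≤ l, good (I t)) ∧
      ∀ t < l, R (I t) (I (t + 1)) := by
  constructor
  · intro h
    induction h with
    | @refl X hX => exact ⟨fun _ => X, rfl, rfl, fun _ _ => hX, by simp⟩
    | @head X Y Z l hX hR _ ih =>
      obtain ⟨I, h0, hl, hg, hs⟩ := ih
      refine ⟨fun t => Nat.casesOn t X I, rfl, hl, ?_, ?_⟩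
      · rintro (_ | t) ht
        · exact hX
        · exact hg t (by omega)
      · rintro (_ | t) ht
        · simpa [h0] using hR
        · exact hs t (by omega)
  · rintro ⟨I, h0, hl, hg, hs⟩
    induction l generalizing I X with
    | zero => subst h0; subst hl; exact .refl (hg 0 le_rfl)
    | succ l ih =>
      subst h0
      exact .head (hg 0 (by omega)) (hs 0 (by omega))
        (ih (fun t => I (t + 1)) rfl hl (fun t ht => hg (t + 1) (by omega))
          (fun t ht => hs (t + 1) (by omega)))

end MoveChain

/-- The token sets allowed in a reconfiguration sequence: independent sets of size `k`. -/
def IsTokenSet {V : Type} (G : SimpleGraph V) (k : ℕ) (S : Finset V) : Prop :=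
  G.IsIndepSet (S : Set V) ∧ S.card = k

theorem ISRInstance.hasSequence_iff (A : ISRInstance)
    (move : SimpleGraph (Fin A.n) → Finset (Fin A.n) → Finset (Fin A.n) → Prop) (l : ℕ) :
    A.HasSequence move l ↔ MoveChain (move A.graph) (IsTokenSet A.graph A.k) l A.init A.fin :=
  (MoveChain.iff_exists_seq (good := IsTokenSet A.graph A.k)).symm

section Transport

variable {V W : Type} {G : SimpleGraph V} {H : SimpleGraph W}

theorem IsTokenSet.map_iso (e : G ≃g H) {k : ℕ} {S : Finset V} (h : IsTokenSet G k S) :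
    IsTokenSet H k (S.map e.toEquiv.toEmbedding) := by
  refine ⟨?_, by simpa using h.2⟩
  intro a ha b hb hab
  simp only [Finset.coe_map, Set.mem_image] at ha hb
  obtain ⟨a, ha, rfl⟩ := ha
  obtain ⟨b, hb, rfl⟩ := hb
  have := h.1 ha hb (fun h => hab (by rw [h]))
  exact fun hadj => this (e.map_adj_iff.1 hadj)

theorem TokenSlide.map_iso [DecidableEq V] [DecidableEq W] (e : G ≃g H) {S T : Finset V}
    (h : TokenSlide G S T) :
    TokenSlide H (S.map e.toEquiv.toEmbedding) (T.map e.toEquiv.toEmbedding) := by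
  obtain ⟨u, hu, v, hv, huv, rfl⟩ := h
  exact ⟨e u, Finset.mem_map_of_mem _ hu, e v,
    by rwa [← Finset.mem_map' e.toEquiv.toEmbedding] at hv, e.map_adj_iff.2 huv,
    by rw [Finset.map_insert, Finset.map_erase]; rfl⟩

theorem MoveChain.map_iso [DecidableEq V] [DecidableEq W] (e : G ≃g H) {k l : ℕ} {S T : Finset V}
    (h : MoveChain (TokenSlide G) (IsTokenSet G k) l S T) :
    MoveChain (TokenSlide H) (IsTokenSet H k) l (S.map e.toEquiv.toEmbedding)
      (T.map e.toEquiv.toEmbedding) :=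
  h.map (Finset.map e.toEquiv.toEmbedding) (fun _ _ => TokenSlide.map_iso e)
    fun _ => IsTokenSet.map_iso e

end Transport

/-! ### Token sets of the copy graph -/

namespace CopyVertex

variable {V : Type} {k : ℕ}

/-- The clique that contains a vertex: `some i` for the clique formed by the `vⁱ` and `fⁱ`, and
`none` for the clique `{z_init, z_fin}`. -/
def clique : CopyVertex V k → Option (Fin k)
  | copy i _ => some i
  | f i => some i
  | zInit => none
  | zFin => none

/-- The set consisting of `z` and of one token `p i` for each `i`. -/
noncomputable def tokens [DecidableEq (CopyVertex V k)] (p : Fin k → CopyVertex V k)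
    (z : CopyVertex V k) : Finset (CopyVertex V k) :=
  insert z (Finset.univ.image p)

@[simp]
theorem mem_tokens [DecidableEq (CopyVertex V k)] {p : Fin k → CopyVertex V k}
    {z w : CopyVertex V k} : w ∈ tokens p z ↔ w = z ∨ ∃ i, p i = w := by
  simp [tokens]

end CopyVertex

namespace ISRInstance

open CopyVertex

variable (A : ISRInstance)

theorem copyGraph_adj_iff (a b : CopyVertex (Fin A.n) A.k) :
    A.copyGraph.Adj a b ↔ a ≠ b ∧ (A.copyRel a b ∨ A.copyRel b a) :=
  SimpleGraph.fromRel_adj _ _ _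

theorem copyGraph_adj_of_clique_eq {a b : CopyVertex (Fin A.n) A.k} (hab : a ≠ b)
    (h : a.clique = b.clique) : A.copyGraph.Adj a b := by
  rw [copyGraph_adj_iff]
  refine ⟨hab, ?_⟩
  cases a <;> cases b <;> simp_all [clique, copyRel]

variable {A}

theorem eq_of_clique_eq {S : Finset (CopyVertex (Fin A.n) A.k)}
    (hS : IsTokenSet A.copyGraph (A.k + 1) S) {a b : CopyVertex (Fin A.n) A.k} (ha : a ∈ S)
    (hb : b ∈ S) (h : a.clique = b.clique) : a = b := by
  by_contra hab
  exact hS.1 ha hb hab (A.copyGraph_adj_of_clique_eq hab h)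

/-- There are as many tokens as cliques, so no clique is free of tokens. -/
theorem exists_mem_clique {S : Finset (CopyVertex (Fin A.n) A.k)}
    (hS : IsTokenSet A.copyGraph (A.k + 1) S) (c : Option (Fin A.k)) : ∃ a ∈ S, a.clique = c := by
  have h : S.image clique = Finset.univ := by
    apply Finset.eq_univ_of_card
    rw [Finset.card_image_of_injOn fun a ha b hb => eq_of_clique_eq hS ha hb, hS.2]
    simp
  have hc := Finset.mem_univ c
  rw [← h] at hc
  simpa using hc

section

variable [DecidableEq (CopyVertex (Fin A.n) A.k)]

theorem card_tokens {p : Fin A.k → CopyVertex (Fin A.n) A.k} {z : CopyVertex (Fin A.n) A.k}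
    (hp : ∀ i, (p i).clique = some i) (hz : z.clique = none) : (tokens p z).card = A.k + 1 := by
  have hinj : Function.Injective p := fun i j h => by simpa [hp] using congrArg clique h
  rw [tokens, Finset.card_insert_of_notMem, Finset.card_image_of_injective _ hinj]
  · simp
  · simp only [Finset.mem_image, Finset.mem_univ, true_and, not_exists]
    rintro i rfl
    simp [hp] at hz

theorem isTokenSet_tokens {p : Fin A.k → CopyVertex (Fin A.n) A.k} {z : CopyVertex (Fin A.n) A.k}
    (hp : ∀ i, (p i).clique = some i) (hz : z.clique = none)
    (hadj : ∀ i j, i ≠ j → ¬ A.copyGraph.Adj (p i) (p j)) (hadjz : ∀ i, ¬ A.copyGraph.Adj (p i) z) :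
    IsTokenSet A.copyGraph (A.k + 1) (tokens p z) := by
  refine ⟨?_, card_tokens hp hz⟩
  rintro a ha b hb hab
  simp only [Finset.mem_coe, mem_tokens] at ha hb
  rcases ha with rfl | ⟨i, rfl⟩ <;> rcases hb with rfl | ⟨j, rfl⟩
  · exact absurd rfl hab
  · exact fun h => hadjz j h.symm
  · exact hadjz i
  · exact hadj i j fun h => hab (by rw [h])

theorem tokenSlide_update {p : Fin A.k → CopyVertex (Fin A.n) A.k} {z : CopyVertex (Fin A.n) A.k}
    (hp : ∀ i, (p i).clique = some i) (hz : z.clique = none) {i : Fin A.k}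
    {w : CopyVertex (Fin A.n) A.k} (hw : w.clique = some i) (hne : w ≠ p i) :
    TokenSlide A.copyGraph (tokens p z) (tokens (Function.update p i w) z) := by
  have hzw : ∀ {a}, a.clique = some i → a ≠ z := by rintro a ha rfl; simp [hz] at ha
  have hpj : ∀ j, p j = p i → j = i := fun j h => by simpa [hp] using congrArg clique h
  have hwj : ∀ j, p j = w → j = i := fun j h => by simpa [hp, hw] using congrArg clique h
  refine ⟨p i, by simp, w, ?_,
    A.copyGraph_adj_of_clique_eq hne.symm (by rw [hp, hw]), ?_⟩
  · simp only [mem_tokens, not_or, not_exists]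
    refine ⟨hzw hw, fun j h => hne ?_⟩
    rw [← h, hwj j h]
  · ext a
    simp only [mem_tokens, Finset.mem_insert, Finset.mem_erase]
    constructor
    · rintro (rfl | ⟨j, rfl⟩)
      · exact .inr ⟨(hzw (hp i)).symm, .inl rfl⟩
      · by_cases hj : j = i
        · subst hj; simp
        · exact .inr ⟨by simpa [hj] using fun h => hj (hpj j h), .inr ⟨j, by simp [hj]⟩⟩
    · rintro (rfl | ⟨ha, rfl | ⟨j, rfl⟩⟩)
      · exact .inr ⟨i, by simp⟩
      · exact .inl rfl
      · exact .inr ⟨j, Function.update_of_ne (fun h => ha (by rw [h])) _ _⟩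

/-- The token sets containing `z_init` are the sets `{(s₁)¹, …, (s_k)ᵏ, z_init}` where
`s₁, …, s_k` is an ordering of an independent set of size `k`. -/
theorem isTokenSet_tokens_copy_zInit_iff {s : Fin A.k → Fin A.n} :
    IsTokenSet A.copyGraph (A.k + 1) (tokens (fun i => copy i (s i)) zInit) ↔
      Function.Injective s ∧ A.graph.IsIndepSet (Set.range s) := by
  constructor
  · intro h
    have key : ∀ i j, i ≠ j → s i ≠ s j ∧ ¬ A.graph.Adj (s i) (s j) := by
      intro i j hij
      have := h.1 (x := copy i (s i)) (by simp) (y := copy j (s j)) (by simp) (by simp [hij])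
      simp only [copyGraph_adj_iff, copyRel] at this
      simp [hij] at this
      tauto
    refine ⟨fun i j hij => by_contra fun hne => (key i j hne).1 hij, ?_⟩
    rintro _ ⟨i, rfl⟩ _ ⟨j, rfl⟩ hij
    exact (key i j fun h => hij (by rw [h])).2
  · rintro ⟨hinj, hind⟩
    refine isTokenSet_tokens (fun _ => rfl) rfl ?_ ?_
    · intro i j hij
      have hs := hinj.ne hij
      have h1 := hind (Set.mem_range_self i) (Set.mem_range_self j) hs
      have h2 := hind (Set.mem_range_self j) (Set.mem_range_self i) hs.symm
      simp [copyGraph_adj_iff, copyRel, hij, hij.symm, hs, hs.symm, h1, h2]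
    · intro i
      simp [copyGraph_adj_iff, copyRel]

theorem exists_eq_tokens_of_zInit_mem {S : Finset (CopyVertex (Fin A.n) A.k)}
    (hS : IsTokenSet A.copyGraph (A.k + 1) S) (hz : zInit ∈ S) :
    ∃ s : Fin A.k → Fin A.n, S = tokens (fun i => copy i (s i)) zInit := by
  have h : ∀ i, ∃ v, copy i v ∈ S := by
    intro i
    obtain ⟨a, ha, hc⟩ := exists_mem_clique hS (some i)
    cases a with
    | copy j v => simp only [clique, Option.some.injEq] at hc; exact ⟨v, hc ▸ ha⟩
    | f j =>
      refine absurd ?_ (hS.1 ha hz (by simp))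
      simp [copyGraph_adj_iff, copyRel]
    | zInit => simp [clique] at hc
    | zFin => simp [clique] at hc
  choose s hs using h
  refine ⟨s, (Finset.eq_of_subset_of_card_le ?_ ?_).symm⟩
  · intro a ha
    rcases mem_tokens.1 ha with rfl | ⟨i, rfl⟩
    · exact hz
    · exact hs i
  · rw [hS.2, card_tokens (fun _ => rfl) rfl]

/-! ### From token jumping to token sliding -/

/-- A jump from `u` to `v` is imitated by the slide from `uⁱ` to `vⁱ`, where `i` is the clique whose
token is on `uⁱ`. -/
theorem moveChain_slide_of_jump {l : ℕ} {S T : Finset (Fin A.n)}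
    (h : MoveChain (TokenJump A.graph) (IsTokenSet A.graph A.k) l S T) {s : Fin A.k → Fin A.n}
    (hs : Function.Injective s) (hsS : Set.range s = (S : Set (Fin A.n))) :
    ∃ s' : Fin A.k → Fin A.n, Function.Injective s' ∧ Set.range s' = (T : Set (Fin A.n)) ∧
      MoveChain (TokenSlide A.copyGraph) (IsTokenSet A.copyGraph (A.k + 1)) l
        (tokens (fun i => copy i (s i)) zInit) (tokens (fun i => copy i (s' i)) zInit) := by
  induction h generalizing s with
  | refl hX =>
    exact ⟨s, hs, hsS, .refl (isTokenSet_tokens_copy_zInit_iff.2 ⟨hs, hsS ▸ hX.1⟩)⟩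
  | @head X _ _ _ hX hR _ ih =>
    obtain ⟨u, hu, v, hv, rfl⟩ := hR
    obtain ⟨i, rfl⟩ : u ∈ Set.range s := by rw [hsS]; exact hu
    have hvs : ∀ j, s j ≠ v := by
      rintro j rfl
      exact hv (Finset.mem_coe.1 (hsS ▸ Set.mem_range_self j))
    have hmem : ∀ w, w ∈ X ↔ ∃ j, s j = w := fun w => by
      rw [← Finset.mem_coe, ← hsS, Set.mem_range]
    have hinj : Function.Injective (Function.update s i v) := by
      intro a b hab
      by_cases ha : a = i <;> by_cases hb : b = i
      · rw [ha, hb]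
      · subst ha; simp [hb] at hab; exact absurd hab.symm (hvs b)
      · subst hb; simp [ha] at hab; exact absurd hab (hvs a)
      · simp [ha, hb] at hab; exact hs hab
    have hrange : Set.range (Function.update s i v) =
        ((insert v (Finset.erase X (s i)) : Finset (Fin A.n)) : Set (Fin A.n)) := by
      ext w
      simp only [Set.mem_range, Finset.coe_insert, Finset.coe_erase, Set.mem_insert_iff,
        Set.mem_sdiff, Finset.mem_coe, hmem, Set.mem_singleton_iff]
      constructor
      · rintro ⟨j, rfl⟩
        by_cases hj : j = i
        · subst hj; simp
        · exact .inr ⟨⟨j, by simp [hj]⟩, by simpa [hj] using fun h => hj (hs h)⟩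
      · rintro (rfl | ⟨⟨j, rfl⟩, hj⟩)
        · exact ⟨i, by simp⟩
        · exact ⟨j, Function.update_of_ne (fun h => hj (by rw [h])) _ _⟩
    obtain ⟨s', hs', hT, hc⟩ := ih (s := Function.update s i v) hinj hrange
    refine ⟨s', hs', hT, .head (isTokenSet_tokens_copy_zInit_iff.2 ⟨hs, hsS ▸ hX.1⟩) ?_ hc⟩
    have := tokenSlide_update (A := A) (p := fun i => copy i (s i)) (z := zInit) (fun _ => rfl)
      rfl (i := i) (w := copy i v) rfl (by simpa using (hvs i).symm)
    convert this using 2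
    funext j
    by_cases hj : j = i
    · subst hj; simp
    · simp [hj]

/-- Once the token of the last clique is on `z_fin`, the other tokens slide to the `fⁱ` one by
one. -/
theorem moveChain_slide_to_f {s : Fin A.k → Fin A.n} (hs : Function.Injective s)
    (hfin : Set.range s = (A.fin : Set (Fin A.n))) (m : ℕ) (hm : m ≤ A.k) :
    MoveChain (TokenSlide A.copyGraph) (IsTokenSet A.copyGraph (A.k + 1)) m
      (tokens (fun i => if (i : ℕ) < m then copy i (s i) else f i) zFin) (tokens f zFin) := by
  have good : ∀ m, IsTokenSet A.copyGraph (A.k + 1)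
      (tokens (fun i => if (i : ℕ) < m then copy i (s i) else f i) zFin) := by
    intro m
    refine isTokenSet_tokens (fun i => ?_) rfl ?_ ?_
    · split <;> rfl
    · intro i j hij
      have hsij := hs.ne hij
      have hind : A.graph.IsIndepSet (Set.range s) := hfin ▸ A.fin_indep
      have h1 := hind (Set.mem_range_self i) (Set.mem_range_self j) hsij
      have h2 := hind (Set.mem_range_self j) (Set.mem_range_self i) hsij.symm
      split <;> split <;>
        simp [copyGraph_adj_iff, copyRel, hij, hij.symm, hsij, hsij.symm, h1, h2]
    · intro i
      have : s i ∈ A.fin := Finset.mem_coe.1 (hfin ▸ Set.mem_range_self i)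
      split <;> simp [copyGraph_adj_iff, copyRel, this]
  induction m with
  | zero =>
    have := good 0
    simp only [Nat.not_lt_zero, if_false] at this ⊢
    exact .refl this
  | succ m ih =>
    refine .head (good _) ?_ (ih (by omega))
    have := tokenSlide_update (A := A)
      (p := fun i => if (i : ℕ) < m + 1 then copy i (s i) else f i) (z := zFin)
      (fun i => by split <;> rfl) rfl (i := ⟨m, hm⟩) (w := f ⟨m, hm⟩) rfl (by simp)
    convert this using 2
    funext j
    by_cases hj : j = ⟨m, hm⟩
    · subst hj; simp
    · have : (j : ℕ) ≠ m := fun h => hj (Fin.ext h)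
      simp only [Function.update_of_ne hj]
      congr 1
      exact propext (by omega)

theorem moveChain_slide_of_jump_fin {l : ℕ} {s : Fin A.k → Fin A.n} (hs : Function.Injective s)
    (hinit : Set.range s = (A.init : Set (Fin A.n)))
    (h : MoveChain (TokenJump A.graph) (IsTokenSet A.graph A.k) l A.init A.fin) :
    MoveChain (TokenSlide A.copyGraph) (IsTokenSet A.copyGraph (A.k + 1)) (l + A.k + 1)
      (tokens (fun i => copy i (s i)) zInit) (tokens f zFin) := by
  obtain ⟨s', hs', hfin, hc⟩ := moveChain_slide_of_jump h hs hinit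
  have hk := moveChain_slide_to_f hs' hfin A.k le_rfl
  simp only [Fin.is_lt, if_true] at hk
  rw [add_assoc]
  refine hc.trans (.head (isTokenSet_tokens_copy_zInit_iff.2 ⟨hs', hfin ▸ A.fin_indep⟩) ?_ hk)
  refine ⟨zInit, by simp, zFin, by simp, by simp [copyGraph_adj_iff, copyRel], ?_⟩
  ext a
  simp only [mem_tokens, Finset.mem_insert, Finset.mem_erase]
  constructor
  · rintro (rfl | ⟨i, rfl⟩) <;> simp
  · rintro (rfl | ⟨h, h' | h'⟩)
    · simp
    · exact absurd h' h
    · exact .inr h'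

/-! ### From token sliding to token jumping -/

/-- As every clique keeps its token, a slide that leaves `z_init` alone stays within one copy of the
vertex set. -/
theorem tokenJump_of_tokenSlide {s t : Fin A.k → Fin A.n} (hs : Function.Injective s)
    (ht : Function.Injective t)
    (h : TokenSlide A.copyGraph (tokens (fun i => copy i (s i)) zInit)
      (tokens (fun i => copy i (t i)) zInit)) :
    TokenJump A.graph (Finset.univ.image s) (Finset.univ.image t) := by
  obtain ⟨u, hu, v, hv, -, hT⟩ := h
  have hT' : ∀ a, a ∈ tokens (fun i => copy i (t i)) zInit ↔ a = v ∨ a ≠ u ∧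
      a ∈ tokens (fun i => copy i (s i)) zInit := fun a => by
    rw [hT, Finset.mem_insert, Finset.mem_erase]
  have hzu : u ≠ zInit := by
    rintro rfl
    have := (hT' zInit).1 (by simp)
    rcases this with rfl | h
    · exact hv (by simp)
    · exact h.1 rfl
  obtain ⟨i, rfl⟩ : ∃ i, copy i (s i) = u := by simpa [hzu] using hu
  have hst : ∀ m, m ≠ i → t m = s m := by
    intro m hm
    have := (hT' (copy m (s m))).2 (.inr ⟨by simp [hm], by simp⟩)
    simp only [mem_tokens, reduceCtorEq, false_or, copy.injEq] at this
    obtain ⟨j, rfl, h⟩ := this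
    exact h
  have hti : t i ≠ s i := by
    intro hti
    have h : s = t := funext fun m => by
      by_cases hm : m = i
      · rw [hm, hti]
      · rw [hst m hm]
    subst h
    exact hv ((hT' v).2 (.inl rfl))
  refine ⟨s i, by simp, t i, ?_, ?_⟩
  · simp only [Finset.mem_image, Finset.mem_univ, true_and, not_exists]
    intro m hm
    by_cases hmi : m = i
    · subst hmi; exact hti hm.symm
    · exact hmi (ht (by rw [hst m hmi, hm]))
  · ext w
    simp only [Finset.mem_image, Finset.mem_univ, true_and, Finset.mem_insert, Finset.mem_erase]
    constructor
    · rintro ⟨m, rfl⟩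
      by_cases hm : m = i
      · exact .inl (by rw [hm])
      · exact .inr ⟨fun h => hm (hs ((hst m hm).symm.trans h)), m, (hst m hm).symm⟩
    · rintro (rfl | ⟨hw, m, rfl⟩)
      · exact ⟨i, rfl⟩
      · exact ⟨m, hst m fun h => hw (by rw [h])⟩

/-- The number of tokens on the vertices `fⁱ`. -/
def fCount (S : Finset (CopyVertex (Fin A.n) A.k)) : ℕ :=
  (Finset.univ.filter fun i => f i ∈ S).card

theorem fCount_le_of_tokenSlide {S T : Finset (CopyVertex (Fin A.n) A.k)}
    (h : TokenSlide A.copyGraph S T) : fCount T ≤ fCount S + 1 := by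
  obtain ⟨u, -, v, -, -, rfl⟩ := h
  have hsub : (Finset.univ.filter fun i => f i ∈ insert v (S.erase u)) ⊆
      (Finset.univ.filter fun i => f i ∈ S) ∪ (Finset.univ.filter fun i => f i = v) := by
    intro i
    simp only [Finset.mem_filter, Finset.mem_insert, Finset.mem_erase, Finset.mem_union,
      Finset.mem_univ, true_and]
    tauto
  refine (Finset.card_le_card hsub).trans ((Finset.card_union_le _ _).trans ?_)
  refine Nat.add_le_add_left (Finset.card_le_one.2 ?_) _
  simp only [Finset.mem_filter, Finset.mem_univ, true_and]
  rintro i rfl j hj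
  simpa using hj.symm

theorem fCount_le_of_moveChain {l : ℕ} {S T : Finset (CopyVertex (Fin A.n) A.k)}
    (h : MoveChain (TokenSlide A.copyGraph) (IsTokenSet A.copyGraph (A.k + 1)) l S T) :
    fCount T ≤ fCount S + l := by
  induction h with
  | refl _ => simp
  | head _ hR _ ih => have := fCount_le_of_tokenSlide hR; omega

/-- As long as `z_init` is occupied, slides of the copies are jumps. When its token leaves, it goes
to `z_fin`, which forces the other tokens to be on copies of the final set; then `k` more slides
are needed to reach the `fⁱ`. -/
theorem moveChain_jump_of_slide {l : ℕ} {S T : Finset (CopyVertex (Fin A.n) A.k)}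
    (h : MoveChain (TokenSlide A.copyGraph) (IsTokenSet A.copyGraph (A.k + 1)) l S T)
    {s : Fin A.k → Fin A.n} (hS : S = tokens (fun i => copy i (s i)) zInit)
    (hT : T = tokens f zFin) :
    ∃ m, m + A.k + 1 ≤ l ∧
      MoveChain (TokenJump A.graph) (IsTokenSet A.graph A.k) m (Finset.univ.image s) A.fin := by
  induction h generalizing s with
  | @refl X hX =>
    have h : zInit ∈ X := by simp [hS]
    simp [hT] at h
  | @head X Y Z l hX hR hc ih =>
    have hinj := isTokenSet_tokens_copy_zInit_iff.1 (hS ▸ hX)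
    have hgood : IsTokenSet A.graph A.k (Finset.univ.image s) :=
      ⟨by simpa using hinj.2, by simp [Finset.card_image_of_injective _ hinj.1]⟩
    have hY := hc.good_left
    by_cases hz : zInit ∈ Y
    · obtain ⟨t, rfl⟩ := exists_eq_tokens_of_zInit_mem hY hz
      obtain ⟨m, hm, hmc⟩ := ih rfl hT
      subst hS
      exact ⟨m + 1, by omega, .head hgood
        (tokenJump_of_tokenSlide hinj.1 (isTokenSet_tokens_copy_zInit_iff.1 hY).1 hR) hmc⟩
    · obtain ⟨u, -, v, -, -, rfl⟩ := hR
      have hu : u = zInit := by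
        by_contra hu
        exact hz (by simp [hS, Ne.symm hu])
      subst hu
      have hzfin : zFin ∈ insert v (X.erase zInit) := by
        obtain ⟨a, ha, hac⟩ := exists_mem_clique hY none
        cases a with
        | zInit => exact absurd ha hz
        | zFin => exact ha
        | copy i v => simp [clique] at hac
        | f i => simp [clique] at hac
      have hv : v = zFin := by simpa [hS, eq_comm] using hzfin
      subst hv
      have himage : Finset.univ.image s = A.fin := by
        refine Finset.eq_of_subset_of_card_le ?_ (by rw [hgood.2, A.fin_card])
        intro w hw
        simp only [Finset.mem_image, Finset.mem_univ, true_and] at hw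
        obtain ⟨i, rfl⟩ := hw
        by_contra hw
        refine hY.1 (x := copy i (s i)) (by simp [hS]) hzfin (by simp) ?_
        simp [copyGraph_adj_iff, copyRel, hw]
      refine ⟨0, ?_, himage ▸ .refl hgood⟩
      -- No `fⁱ` is occupied yet, all are at the end, and a slide occupies at most one more.
      have hle := fCount_le_of_moveChain hc
      have h0 : fCount (insert zFin (X.erase zInit)) = 0 := by
        simp [fCount, hS]
      have hk : fCount Z = A.k := by
        simp [fCount, hT]
      omega

end

/-- The lengths of sequences for an instance and for any instance on its copy graph. -/
theorem exists_hasTSSequence_le_iff {A B : ISRInstance} (h : A.IsCopyInstance B) :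
    (∀ l : ℕ, (∃ m ≤ l, A.HasTJSequence m) ↔ ∃ m ≤ l + A.k + 1, B.HasTSSequence m) ∧
      ∀ l : ℕ, A.HasTJSequence l → B.HasTSSequence (l + A.k + 1) := by
  classical
  obtain ⟨hk, s, hs, hinit, e, hBinit, hBfin⟩ := h
  have hi : (tokens (fun i => copy i (s i)) zInit).map e.toEquiv.toEmbedding = B.init := by
    ext b
    obtain ⟨w, rfl⟩ := e.surjective b
    rw [hBinit]
    exact (Finset.mem_map' _).trans (by simp [eq_comm])
  have hf : (tokens f zFin).map e.toEquiv.toEmbedding = B.fin := by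
    ext b
    obtain ⟨w, rfl⟩ := e.surjective b
    rw [hBfin]
    exact (Finset.mem_map' _).trans (by simp [eq_comm])
  have hi' : B.init.map e.symm.toEquiv.toEmbedding = tokens (fun i => copy i (s i)) zInit := by
    rw [← hi, Finset.map_map]; ext; simp
  have hf' : B.fin.map e.symm.toEquiv.toEmbedding = tokens f zFin := by
    rw [← hf, Finset.map_map]; ext; simp
  have forth : ∀ l : ℕ, A.HasTJSequence l → B.HasTSSequence (l + A.k + 1) := by
    intro l h
    rw [HasTJSequence, hasSequence_iff] at h
    rw [HasTSSequence, hasSequence_iff, ← hi, ← hf, hk]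
    exact (moveChain_slide_of_jump_fin hs hinit h).map_iso e
  refine ⟨fun l => ⟨?_, ?_⟩, forth⟩
  · rintro ⟨m, hm, h⟩
    exact ⟨m + A.k + 1, by omega, forth m h⟩
  · rintro ⟨m, hm, h⟩
    rw [HasTSSequence, hasSequence_iff, hk] at h
    have := h.map_iso e.symm
    obtain ⟨m', hm', hc⟩ := moveChain_jump_of_slide this hi' hf'
    refine ⟨m', by omega, ?_⟩
    rw [HasTJSequence, hasSequence_iff]
    convert hc
    ext v
    simp [← Finset.mem_coe, ← hinit]

end ISRInstance

/-! ### The constructed instance -/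

open CopyVertex

/-- The vertices of the copy graph in the order in which the constructed instance numbers them:
each copy of the vertex set is followed by its `fⁱ`, and `z_init` and `z_fin` come last. -/
def copyVertices (n k : ℕ) : List (CopyVertex (Fin n) k) :=
  ((List.finRange k).flatMap fun i => (List.finRange n).map (copy i) ++ [f i]) ++ [zInit, zFin]

theorem nodup_copyVertices (n k : ℕ) : (copyVertices n k).Nodup := by
  rw [copyVertices, List.nodup_append']
  refine ⟨List.nodup_flatMap.2 ⟨fun i _ => ?_, ?_⟩, by simp, ?_⟩
  · rw [List.nodup_append']
    refine ⟨(List.nodup_finRange n).map fun a b h => by simpa using h, by simp, by simp⟩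
  · refine (List.nodup_finRange k).imp ?_
    intro i j hij
    simp only [Function.onFun, List.disjoint_left, List.mem_append, List.mem_map,
      List.mem_finRange, true_and, List.mem_singleton]
    rintro a (⟨v, rfl⟩ | rfl) <;> simp [eq_comm, hij]
  · simp

theorem mem_copyVertices {n k : ℕ} (w : CopyVertex (Fin n) k) : w ∈ copyVertices n k := by
  cases w <;> simp [copyVertices]

theorem flatMap_copyVertices {n k : ℕ} (F : CopyVertex (Fin n) k → List Bool) :
    (copyVertices n k).flatMap F =
      ((List.finRange k).flatMap fun i =>
        ((List.finRange n).flatMap fun v => F (copy i v)) ++ F (f i)) ++ (F zInit ++ F zFin) := by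
  simp [copyVertices, List.flatMap_assoc, List.flatMap_append, List.flatMap_map]

open Classical in
/-- The number of a vertex of the copy graph. -/
noncomputable def copyVertexEquiv (n k : ℕ) :
    CopyVertex (Fin n) k ≃ Fin (copyVertices n k).length :=
  ((nodup_copyVertices n k).getEquivOfForallMemList _ mem_copyVertices).symm

theorem map_finRange_copyVertices {n k : ℕ} {α : Type} (F : CopyVertex (Fin n) k → α) :
    ((List.finRange (copyVertices n k).length).map fun v => F ((copyVertexEquiv n k).symm v)) =
      (copyVertices n k).map F := by
  conv_rhs => rw [← List.map_get_finRange (copyVertices n k), List.map_map]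
  rfl

namespace ISRInstance

open Classical in
/-- The tokens `{(s₁)¹, …, (s_k)ᵏ, z_init}`, where `s₁ < … < s_k` are the elements of the initial
set. -/
noncomputable def copyInit (A : ISRInstance) : Finset (CopyVertex (Fin A.n) A.k) :=
  tokens (fun i => copy i (A.init.orderEmbOfFin A.init_card i)) zInit

open Classical in
/-- The tokens `{f¹, …, fᵏ, z_fin}`. -/
noncomputable def copyFin (A : ISRInstance) : Finset (CopyVertex (Fin A.n) A.k) :=
  tokens f zFin

theorem isTokenSet_copyInit (A : ISRInstance) :
    IsTokenSet A.copyGraph (A.k + 1) A.copyInit := by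
  classical
  refine isTokenSet_tokens_copy_zInit_iff.2 ⟨(A.init.orderEmbOfFin A.init_card).injective, ?_⟩
  rw [Finset.range_orderEmbOfFin]
  exact A.init_indep

theorem isTokenSet_copyFin (A : ISRInstance) :
    IsTokenSet A.copyGraph (A.k + 1) A.copyFin := by
  classical
  refine isTokenSet_tokens (fun _ => rfl) rfl ?_ ?_ <;>
    simp [copyGraph_adj_iff, copyRel]

/-- The copy graph on the vertices `0, 1, 2, …`. -/
noncomputable def copyIso (A : ISRInstance) :
    A.copyGraph ≃g A.copyGraph.comap (copyVertexEquiv A.n A.k).symm :=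
  (SimpleGraph.Iso.comap (copyVertexEquiv A.n A.k).symm A.copyGraph).symm

/-- The instance on the copy graph. -/
noncomputable def copyInstance (A : ISRInstance) : ISRInstance where
  n := (copyVertices A.n A.k).length
  graph := A.copyGraph.comap (copyVertexEquiv A.n A.k).symm
  init := A.copyInit.map (copyVertexEquiv A.n A.k).toEmbedding
  fin := A.copyFin.map (copyVertexEquiv A.n A.k).toEmbedding
  k := A.k + 1
  init_indep := (A.isTokenSet_copyInit.map_iso A.copyIso).1
  fin_indep := (A.isTokenSet_copyFin.map_iso A.copyIso).1
  init_card := (A.isTokenSet_copyInit.map_iso A.copyIso).2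
  fin_card := (A.isTokenSet_copyFin.map_iso A.copyIso).2

theorem isCopyInstance_copyInstance (A : ISRInstance) : A.IsCopyInstance A.copyInstance := by
  classical
  refine ⟨rfl, A.init.orderEmbOfFin A.init_card, (A.init.orderEmbOfFin A.init_card).injective,
    Finset.range_orderEmbOfFin _ _, A.copyIso, fun w => ?_, fun w => ?_⟩
  · refine (Finset.mem_map' (copyVertexEquiv A.n A.k).toEmbedding).trans ?_
    simp [copyInit, eq_comm]
  · refine (Finset.mem_map' (copyVertexEquiv A.n A.k).toEmbedding).trans ?_
    simp [copyFin, eq_comm]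

open Classical in
theorem encode_copyInstance (A : ISRInstance) :
    A.copyInstance.encode =
      List.replicate (copyVertices A.n A.k).length true ++ [false] ++
      ((copyVertices A.n A.k).flatMap fun u =>
        (copyVertices A.n A.k).map fun v => decide (A.copyGraph.Adj u v)) ++
      ((copyVertices A.n A.k).map fun v => decide (v ∈ A.copyInit)) ++
      ((copyVertices A.n A.k).map fun v => decide (v ∈ A.copyFin)) ++
      List.replicate (A.k + 1) true := by
  have h1 := map_finRange_copyVertices (fun v => decide (v ∈ A.copyInit))
  have h2 := map_finRange_copyVertices (fun v => decide (v ∈ A.copyFin))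
  have h3 := fun u => map_finRange_copyVertices (fun v => decide (A.copyGraph.Adj u v))
  have h4 := map_finRange_copyVertices (fun u =>
        (copyVertices A.n A.k).map fun v => decide (A.copyGraph.Adj u v))
  rw [List.flatMap_def, ← h4, ← h1, ← h2]
  simp_rw [← h3, ← List.flatMap_def]
  have hmem : ∀ (S : Finset (CopyVertex (Fin A.n) A.k)) v,
      v ∈ S.map (copyVertexEquiv A.n A.k).toEmbedding ↔ (copyVertexEquiv A.n A.k).symm v ∈ S := by
    intro S v
    simp [Finset.mem_map_equiv]
  simp only [encode, copyInstance, List.append_assoc, SimpleGraph.comap_adj]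
  congr! 6
  · exact decide_eq_decide.2 (hmem _ _)
  · exact funext fun v => decide_eq_decide.2 (hmem _ v)

end ISRInstance

/-! ### Fragments of machines -/

/-- The work alphabet. The first cell of a work tape holds `mark`. -/
inductive WorkSymbol where
  | blank
  | mark
  | bit (b : Bool)

theorem WorkSymbol.finite : Finite WorkSymbol :=
  Finite.of_injective
    (fun | .blank => (none : Option (Option Bool)) | .mark => some none | .bit b => some (some b))
    (by rintro (_ | _ | _) (_ | _ | _) <;> simp)

/-- A piece of a machine with `t` work tapes. When it halts, `result` reads off the outcome of a
test from its state. -/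
structure Fragment (t : ℕ) where
  State : Type
  finiteState : Finite State
  start : State
  result : State → Bool
  trans : State → InputSymbol → (Fin t → WorkSymbol) → Option (MachineAction State WorkSymbol t)

/-- A configuration without the state. -/
@[ext]
structure Memory (t : ℕ) where
  inputHead : ℕ
  work : Fin t → ℕ → WorkSymbol
  head : Fin t → ℕ
  output : List Bool

namespace MachineAction

variable {Q Q' : Type} {t : ℕ}

/-- The same action with the next state renamed. -/
def mapNext (φ : Q → Q') (a : MachineAction Q WorkSymbol t) : MachineAction Q' WorkSymbol t where
  next := φ a.next
  inputMove := a.inputMove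
  write := a.write
  workMove := a.workMove
  emit := a.emit

/-- Go to state `q` and change nothing else, where `w` are the symbols read. -/
def goto (q : Q) (w : Fin t → WorkSymbol) : MachineAction Q WorkSymbol t where
  next := q
  inputMove := .stay
  write := w
  workMove := fun _ => .stay
  emit := none

end MachineAction

namespace Memory

variable {t : ℕ}

/-- The effect of an action on input `x`. -/
def apply {Q : Type} (x : List Bool) (m : Memory t) (a : MachineAction Q WorkSymbol t) :
    Memory t where
  inputHead := Transducer.moveInput x m.inputHead a.inputMove
  work := fun i => Function.update (m.work i) (m.head i) (a.write i)
  head := fun i => Transducer.moveWork (m.head i) (a.workMove i)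
  output := m.output ++ a.emit.toList

/-- The symbols under the work heads. -/
def scanned (m : Memory t) : Fin t → WorkSymbol := fun i => m.work i (m.head i)

@[simp]
theorem apply_goto {Q : Type} (x : List Bool) (m : Memory t) (q : Q) :
    m.apply x (.goto q m.scanned) = m := by
  ext <;> simp [apply, MachineAction.goto, Transducer.moveInput, Transducer.moveWork, scanned]

/-- All work heads are on the first `s` cells. -/
def Within (s : ℕ) (m : Memory t) : Prop := ∀ i, m.head i < s

end Memory

namespace Fragment

variable {t : ℕ}

/-- One step of a fragment on input `x`. -/
def step (M : Fragment t) (x : List Bool) (c : M.State × Memory t) :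
    Option (M.State × Memory t) :=
  (M.trans c.1 (Transducer.inputAt x c.2.inputHead) c.2.scanned).map fun a =>
    (a.next, c.2.apply x a)

/-- Some number of steps, during which the work heads stay on the first `s` cells. -/
def Steps (M : Fragment t) (x : List Bool) (s : ℕ) :
    M.State × Memory t → M.State × Memory t → Prop :=
  Relation.ReflTransGen fun c d => M.step x c = some d ∧ d.2.Within s

/-- Started on `m`, the fragment halts with memory `m'` and outcome `b`, and meanwhile the work
heads stay on the first `s` cells. -/
def Runs (M : Fragment t) (x : List Bool) (s : ℕ) (m m' : Memory t) (b : Bool) : Prop :=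
  ∃ q, M.Steps x s (M.start, m) (q, m') ∧ 
    M.trans q (Transducer.inputAt x m'.inputHead) m'.scanned = none ∧ M.result q = b

variable {x : List Bool} {s : ℕ} {m m₁ m₂ : Memory t} {b : Bool}

theorem step_eq_some {M : Fragment t} {q : M.State} {a : MachineAction M.State WorkSymbol t}
    (h : M.trans q (Transducer.inputAt x m.inputHead) m.scanned = some a) :
    M.step x (q, m) = some (a.next, m.apply x a) := by
  simp [step, h]

theorem Steps.single {M : Fragment t} {q : M.State} {a : MachineAction M.State WorkSymbol t}
    (h : M.trans q (Transducer.inputAt x m.inputHead) m.scanned = some a)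
    (hs : (m.apply x a).Within s) : M.Steps x s (q, m) (a.next, m.apply x a) :=
  Relation.ReflTransGen.single ⟨step_eq_some h, hs⟩

theorem Steps.within {M : Fragment t} {c d : M.State × Memory t} (h : M.Steps x s c d)
    (hc : c.2.Within s) : d.2.Within s := by
  induction h with
  | refl => exact hc
  | tail _ h _ => exact h.2

theorem Runs.within {M : Fragment t} (h : M.Runs x s m m₁ b) (hm : m.Within s) : m₁.Within s := by
  obtain ⟨q, h, -, -⟩ := h
  exact Steps.within h hm

/-- Steps of `M` are steps of a fragment that contains `M`. -/
theorem Steps.embed {M N : Fragment t} (φ : M.State → N.State)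
    (hφ : ∀ q i w a, M.trans q i w = some a → N.trans (φ q) i w = some (a.mapNext φ))
    {c d : M.State × Memory t} (h : M.Steps x s c d) :
    N.Steps x s (φ c.1, c.2) (φ d.1, d.2) := by
  induction h with
  | refl => exact .refl
  | @tail c d _ h ih =>
    refine ih.tail ⟨?_, h.2⟩
    obtain ⟨q, m⟩ := c
    have h := h.1
    simp only [step, Option.map_eq_some_iff] at h
    obtain ⟨a, ha, rfl⟩ := h
    exact step_eq_some (hφ _ _ _ _ ha)

theorem Steps.goto {M : Fragment t} {q q' : M.State} (hm : m.Within s)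
    (h : M.trans q (Transducer.inputAt x m.inputHead) m.scanned = some (.goto q' m.scanned)) :
    M.Steps x s (q, m) (q', m) := by
  have := Steps.single h (s := s) (by simpa using hm)
  rwa [Memory.apply_goto] at this

/-- `P`, then `Q`. -/
def seq (P Q : Fragment t) : Fragment t where
  State := P.State ⊕ Q.State
  finiteState := by
    have := P.finiteState
    have := Q.finiteState
    infer_instance
  start := .inl P.start
  result := fun _ => false
  trans
    | .inl q, i, w =>
      match P.trans q i w with
      | some a => some (a.mapNext .inl)
      | none => some (.goto (.inr Q.start) w)
    | .inr q, i, w => (Q.trans q i w).map (.mapNext .inr)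

theorem Runs.seq {P Q : Fragment t} {b b' : Bool} (hm : m.Within s) (hP : P.Runs x s m m₁ b)
    (hQ : Q.Runs x s m₁ m₂ b') : (P.seq Q).Runs x s m m₂ false := by
  have hm₁ := hP.within hm
  obtain ⟨p, hp, hp', -⟩ := hP
  obtain ⟨q, hq, hq', -⟩ := hQ
  refine ⟨.inr q, ?_, by simp [Fragment.seq, hq'], rfl⟩
  refine (hp.embed (N := P.seq Q) .inl fun q i w a h => by simp [Fragment.seq, h]).trans
    (Relation.ReflTransGen.trans (Steps.goto hm₁ ?_)
      (hq.embed (N := P.seq Q) .inr fun q i w a h => by simp [Fragment.seq, h]))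
  simp [Fragment.seq, hp']

/-- `P` if the test `T` succeeds, `Q` otherwise. -/
def cond (T P Q : Fragment t) : Fragment t where
  State := T.State ⊕ P.State ⊕ Q.State
  finiteState := by
    have := T.finiteState
    have := P.finiteState
    have := Q.finiteState
    infer_instance
  start := .inl T.start
  result := fun _ => false
  trans
    | .inl q, i, w =>
      match T.trans q i w with
      | some a => some (a.mapNext .inl)
      | none => some (.goto (.inr (if T.result q then .inl P.start else .inr Q.start)) w)
    | .inr (.inl q), i, w => (P.trans q i w).map (.mapNext fun q => .inr (.inl q))
    | .inr (.inr q), i, w => (Q.trans q i w).map (.mapNext fun q => .inr (.inr q))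

theorem Runs.cond {T P Q : Fragment t} {b c : Bool} (hm : m.Within s) (hT : T.Runs x s m m₁ b)
    (hPQ : (if b then P else Q).Runs x s m₁ m₂ c) : (T.cond P Q).Runs x s m m₂ false := by
  have hm₁ := hT.within hm
  obtain ⟨p, hp, hp', hb⟩ := hT
  have h₁ := hp.embed (N := T.cond P Q) .inl fun q i w a h => by simp [Fragment.cond, h]
  cases b
  · simp only [Bool.false_eq_true, if_false] at hPQ
    obtain ⟨q, hq, hq', -⟩ := hPQ
    refine ⟨.inr (.inr q), h₁.trans (Relation.ReflTransGen.trans (Steps.goto hm₁ ?_)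
      (hq.embed (N := T.cond P Q) (fun q => .inr (.inr q)) fun q i w a h => by
        simp [Fragment.cond, h])),
      by simp [Fragment.cond, hq'], rfl⟩
    simp [Fragment.cond, hp', hb]
  · simp only [if_true] at hPQ
    obtain ⟨q, hq, hq', -⟩ := hPQ
    refine ⟨.inr (.inl q), h₁.trans (Relation.ReflTransGen.trans (Steps.goto hm₁ ?_)
      (hq.embed (N := T.cond P Q) (fun q => .inr (.inl q)) fun q i w a h => by
        simp [Fragment.cond, h])),
      by simp [Fragment.cond, hq'], rfl⟩
    simp [Fragment.cond, hp', hb]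

/-- As long as the test `T` succeeds, `P`. -/
def whileDo (T P : Fragment t) : Fragment t where
  State := T.State ⊕ P.State
  finiteState := by
    have := T.finiteState
    have := P.finiteState
    infer_instance
  start := .inl T.start
  result := fun _ => false
  trans
    | .inl q, i, w =>
      match T.trans q i w with
      | some a => some (a.mapNext .inl)
      | none => if T.result q then some (.goto (.inr P.start) w) else none
    | .inr q, i, w =>
      match P.trans q i w with
      | some a => some (a.mapNext .inr)
      | none => some (.goto (.inl T.start) w)

theorem Runs.whileDo_false {T P : Fragment t} (hT : T.Runs x s m m₁ false) :
    (T.whileDo P).Runs x s m m₁ false := by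
  obtain ⟨p, hp, hp', hb⟩ := hT
  refine ⟨.inl p, hp.embed (N := T.whileDo P) .inl fun q i w a h => by simp [whileDo, h], ?_, rfl⟩
  simp [whileDo, hp', hb]

theorem Runs.whileDo_true {T P : Fragment t} {m₃ : Memory t} {b c : Bool} (hm : m.Within s)
    (hT : T.Runs x s m m₁ true) (hP : P.Runs x s m₁ m₂ b) (hW : (T.whileDo P).Runs x s m₂ m₃ c) :
    (T.whileDo P).Runs x s m m₃ c := by
  have hm₁ := hT.within hm
  have hm₂ := hP.within hm₁
  obtain ⟨p, hp, hp', hb⟩ := hT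
  obtain ⟨q, hq, hq', -⟩ := hP
  obtain ⟨r, hr, hr', hc⟩ := hW
  refine ⟨r, Relation.ReflTransGen.trans
    (hp.embed (N := T.whileDo P) .inl fun q i w a h => by simp [whileDo, h])
    (Relation.ReflTransGen.trans (Steps.goto hm₁ (M := T.whileDo P) (q := .inl p)
      (q' := .inr P.start) ?_)
      (Relation.ReflTransGen.trans
        (hq.embed (N := T.whileDo P) .inr fun q i w a h => by simp [whileDo, h])
        (Relation.ReflTransGen.trans (Steps.goto (M := T.whileDo P) (q := .inr q) hm₂ ?_)
          hr))), hr', hc⟩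
  · simp [whileDo, hp', hb]
  · simp [whileDo, hq']

/-- The opposite test. -/
def not (T : Fragment t) : Fragment t :=
  { T with result := fun q => !T.result q }

theorem Runs.not {T : Fragment t} {b : Bool} (h : T.Runs x s m m₁ b) :
    T.not.Runs x s m m₁ !b := by
  obtain ⟨q, h, h', rfl⟩ := h
  exact ⟨q, h, h', rfl⟩

/-- The fragment as a complete machine. -/
def toTransducer (M : Fragment t) : Transducer where
  State := M.State
  finiteState := M.finiteState
  Symbol := WorkSymbol
  finiteSymbol := WorkSymbol.finite
  blank := .blank
  tapes := t
  start := M.start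
  trans := M.trans

/-- The memory of a machine that has not started yet. -/
def _root_.Memory.initial (t : ℕ) : Memory t where
  inputHead := 0
  work := fun _ _ => .blank
  head := fun _ => 0
  output := []

/-- A configuration of the complete machine. -/
def toConfig (M : Fragment t) (c : M.State × Memory t) : M.toTransducer.Config where
  state := c.1
  inputHead := c.2.inputHead
  work := c.2.work
  head := c.2.head
  output := c.2.output

theorem step_toTransducer (M : Fragment t) (c : M.State × Memory t) :
    M.toTransducer.step x (M.toConfig c) = (M.step x c).map M.toConfig := by
  simp only [step, Option.map_map]
  rfl

theorem Runs.computesInSpace {M : Fragment t} (hs : 0 < s)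
    (h : M.Runs x s (.initial t) m b) : M.toTransducer.ComputesInSpace x m.output s := by
  obtain ⟨q, h, hq, -⟩ := h
  replace hq : M.step x (q, m) = none := by simp [step, hq]
  refine ⟨⟨M.toConfig (q, m), ?_, by rw [step_toTransducer, hq]; rfl, rfl⟩, ?_⟩
  · refine h.lift M.toConfig fun c d hcd => ?_
    exact (M.step_toTransducer c).trans (by rw [hcd.1]; rfl)
  · -- The run is deterministic, so every configuration reached lies on the halting run `h`.
    have key : ∀ c₀ c₁, M.Steps x s c₀ c₁ → M.step x c₁ = none → c₀.2.Within s →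
        ∀ c, Relation.ReflTransGen (fun c d => M.toTransducer.step x c = some d)
          (M.toConfig c₀) c → ∀ i, c.head i < s := by
      intro c₀ c₁ h hnone
      induction h using Relation.ReflTransGen.head_induction_on with
      | refl =>
        intro hw c hc
        rcases hc.cases_head with rfl | ⟨d, hd, -⟩
        · exact hw
        · simp [step_toTransducer, hnone] at hd
      | head hcd _ ih =>
        intro hw c hc
        rcases hc.cases_head with rfl | ⟨d, hd, hdc⟩
        · exact hw
        · rw [step_toTransducer, hcd.1] at hd
          cases hd
          exact ih hcd.2 _ hdc
    exact fun c hc => key _ _ h hq (fun _ => hs) c hc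

end Fragment

/-! ### Counters in binary -/

/-- The content of a cell that holds a binary digit or nothing. -/
def digit : Option Bool → WorkSymbol
  | some b => .bit b
  | none => .blank

theorem digit_ne_mark (b : Option Bool) : digit b ≠ .mark := by
  cases b <;> simp [digit]

/-- The tape with `mark` on its first cell and the digits `L` behind it. -/
def digitTape (L : List Bool) : ℕ → WorkSymbol
  | 0 => .mark
  | p + 1 => digit L[p]?

/-- Addition of one to a binary number, least significant digit first. -/
def succBits : List Bool → List Bool
  | [] => [true]
  | false :: L => true :: L
  | true :: L => false :: succBits L

theorem bits_succ (n : ℕ) : (n + 1).bits = succBits n.bits := by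
  induction n using Nat.strong_induction_on with
  | _ n ih =>
    rcases Nat.even_or_odd' n with ⟨m, rfl | rfl⟩
    · rw [Nat.bit1_bits]
      rcases Nat.eq_zero_or_pos m with rfl | hm
      · simp [succBits]
      · rw [Nat.bit0_bits _ hm.ne', succBits]
    · rw [Nat.bit1_bits, succBits, ← ih m (by omega), ← Nat.bit0_bits _ (Nat.succ_ne_zero m)]
      rfl

namespace Memory

variable {t : ℕ}

/-- Put the work heads in `R` on cell `p`. -/
def setHeads (m : Memory t) (R : Finset (Fin t)) (p : ℕ) : Memory t :=
  { m with head := fun i => if i ∈ R then p else m.head i }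

/-- Replace the content of tape `r` by `W` and put its head on cell `p`. -/
def setTape (m : Memory t) (r : Fin t) (W : ℕ → WorkSymbol) (p : ℕ) : Memory t :=
  { m with work := Function.update m.work r W }.setHeads {r} p

theorem within_setHeads {m : Memory t} {s : ℕ} (hm : m.Within s) {R : Finset (Fin t)} {p : ℕ}
    (hp : p < s) : (m.setHeads R p).Within s := by
  intro i
  simp only [setHeads]
  split
  · exact hp
  · exact hm i

theorem within_setTape {m : Memory t} {s : ℕ} (hm : m.Within s) {r : Fin t} {W : ℕ → WorkSymbol}
    {p : ℕ} (hp : p < s) : (m.setTape r W p).Within s :=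
  within_setHeads (m := { m with work := Function.update m.work r W }) hm hp

@[simp]
theorem scanned_setTape (m : Memory t) (r : Fin t) (W : ℕ → WorkSymbol) (p : ℕ) :
    (m.setTape r W p).scanned r = W p := by
  simp [scanned, setTape, setHeads]

theorem scanned_setHeads (m : Memory t) {R : Finset (Fin t)} {r : Fin t} (hr : r ∈ R) (p : ℕ) :
    (m.setHeads R p).scanned r = m.work r p := by
  simp [scanned, setHeads, hr]

end Memory

namespace MachineAction

variable {Q : Type} {t : ℕ}

/-- Write `c` on tape `r`, move its head, and go to state `q`. -/
def onTape (q : Q) (r : Fin t) (c : WorkSymbol) (d : HeadMove) (w : Fin t → WorkSymbol) :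
    MachineAction Q WorkSymbol t :=
  { goto q w with
    write := Function.update w r c
    workMove := fun i => if i ∈ ({r} : Finset (Fin t)) then d else .stay }

/-- Move the heads in `R` and go to state `q`. -/
def moveHeads (q : Q) (R : Finset (Fin t)) (d : HeadMove) (w : Fin t → WorkSymbol) :
    MachineAction Q WorkSymbol t :=
  { goto q w with workMove := fun i => if i ∈ R then d else .stay }

end MachineAction

namespace Memory

variable {t : ℕ} {Q : Type}

theorem apply_onTape (x : List Bool) (m : Memory t) (q : Q) (r : Fin t) (W : ℕ → WorkSymbol)
    (p : ℕ) (c : WorkSymbol) (d : HeadMove) :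
    (m.setTape r W p).apply x (.onTape q r c d (m.setTape r W p).scanned) =
      m.setTape r (Function.update W p c) (Transducer.moveWork p d) := by
  ext i j
  · rfl
  · by_cases hi : i = r
    · subst hi
      simp [apply, MachineAction.onTape, setTape, setHeads]
    · simp [apply, MachineAction.onTape, setTape, setHeads, hi, scanned]
  · by_cases hi : i = r
    · subst hi
      simp [apply, MachineAction.onTape, setTape, setHeads]
    · simp [apply, MachineAction.onTape, setTape, setHeads, hi, Transducer.moveWork]
  · simp [apply, MachineAction.onTape, setTape, setHeads, MachineAction.goto]

theorem apply_moveHeads (x : List Bool) (m : Memory t) (q : Q) (R : Finset (Fin t)) (p : ℕ)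
    (d : HeadMove) :
    (m.setHeads R p).apply x (.moveHeads q R d (m.setHeads R p).scanned) =
      m.setHeads R (Transducer.moveWork p d) := by
  ext i j
  · rfl
  · simp [apply, MachineAction.moveHeads, MachineAction.goto, setHeads, scanned]
  · by_cases hi : i ∈ R <;>
      simp [apply, MachineAction.moveHeads, setHeads, hi, Transducer.moveWork]
  · simp [apply, MachineAction.moveHeads, setHeads, MachineAction.goto]

end Memory

namespace Fragment

variable {t : ℕ} {x : List Bool} {s : ℕ} {m : Memory t}

theorem Steps.onTape {M : Fragment t} {q q' : M.State} {r : Fin t} {W : ℕ → WorkSymbol}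
    {p p' : ℕ} {c : WorkSymbol} (d : HeadMove) (hp' : Transducer.moveWork p d = p')
    (hm : m.Within s) (hp : p' < s)
    (h : ∀ i w, w r = W p → M.trans q i w = some (.onTape q' r c d w)) :
    M.Steps x s (q, m.setTape r W p)
      (q', m.setTape r (Function.update W p c) p') := by
  subst hp'
  have := Steps.single (h (Transducer.inputAt x (m.setTape r W p).inputHead)
    (m.setTape r W p).scanned (by simp)) (s := s)
    (by rw [Memory.apply_onTape]; exact Memory.within_setTape hm hp)
  rwa [Memory.apply_onTape] at this

theorem Steps.moveHeads {M : Fragment t} {q q' : M.State} {R : Finset (Fin t)} {p p' : ℕ}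
    (d : HeadMove) (hp' : Transducer.moveWork p d = p') (hm : m.Within s) (hp : p' < s)
    (h : ∀ i w, (∀ r ∈ R, w r = m.work r p) → M.trans q i w = some (.moveHeads q' R d w)) :
    M.Steps x s (q, m.setHeads R p) (q', m.setHeads R p') := by
  subst hp'
  have := Steps.single (h (Transducer.inputAt x (m.setHeads R p).inputHead)
    (m.setHeads R p).scanned (fun r hr => m.scanned_setHeads hr p)) (s := s)
    (by rw [Memory.apply_moveHeads]; exact Memory.within_setHeads hm hp)
  rwa [Memory.apply_moveHeads] at this

/-- Heads that move left together until tape `r` shows `mark` end on the first cell. -/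
theorem Steps.moveHeads_back {M : Fragment t} {q : M.State} {R : Finset (Fin t)} {r : Fin t}
    (hr : r ∈ R)
    (h : ∀ i w, w r ≠ .mark → M.trans q i w = some (.moveHeads q R .left w)) (hm : m.Within s)
    (hmark : ∀ j, m.work r (j + 1) ≠ .mark) {p : ℕ} (hp : p < s) :
    M.Steps x s (q, m.setHeads R p) (q, m.setHeads R 0) := by
  induction p with
  | zero => exact .refl
  | succ p ih =>
    exact Relation.ReflTransGen.trans (Steps.moveHeads .left (Nat.add_sub_cancel p 1) hm
      (by omega) fun i w hw => h i w (by rw [hw r hr]; exact hmark p)) (ih (by omega))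

/-- The states of the operations on counters. -/
inductive CounterState where
  | start
  | scan
  | back (b : Bool)

theorem CounterState.finite : Finite CounterState :=
  Finite.of_injective
    (fun | .start => (none : Option (Option Bool)) | .scan => some none | .back b => some (some b))
    (by rintro (_ | _ | _) (_ | _ | _) <;> simp)

/-- The outcome of an operation on counters. -/
def CounterState.result : CounterState → Bool
  | .back b => b
  | _ => false

/-- Add one to counter `r`. -/
def inc (r : Fin t) : Fragment t where
  State := CounterState
  finiteState := CounterState.finite
  start := .start
  result := CounterState.result
  trans
    | .start, _, w => some (.onTape .scan r .mark .right w)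
    | .scan, _, w =>
      match w r with
      | .bit true => some (.onTape .scan r (.bit false) .right w)
      | _ => some (.onTape (.back true) r (.bit true) .left w)
    | .back b, _, w =>
      match w r with
      | .mark => none
      | _ => some (.moveHeads (.back b) {r} .left w)

/-- Set counter `r` to zero. -/
def zero (r : Fin t) : Fragment t where
  State := CounterState
  finiteState := CounterState.finite
  start := .start
  result := CounterState.result
  trans
    | .start, _, w => some (.onTape .scan r .mark .right w)
    | .scan, _, w =>
      match w r with
      | .bit _ => some (.onTape .scan r .blank .right w)
      | _ => some (.onTape (.back true) r .blank .left w)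
    | .back b, _, w =>
      match w r with
      | .mark => none
      | _ => some (.moveHeads (.back b) {r} .left w)

/-- Test whether counters `r` and `r'` are equal. As binary representations have no leading zeros,
it is enough to compare the digits. -/
def eq (r r' : Fin t) : Fragment t where
  State := CounterState
  finiteState := CounterState.finite
  start := .start
  result := CounterState.result
  trans
    | .start, _, w => some (.moveHeads .scan {r, r'} .right w)
    | .scan, _, w =>
      match w r, w r' with
      | .bit true, .bit true => some (.moveHeads .scan {r, r'} .right w)
      | .bit false, .bit false => some (.moveHeads .scan {r, r'} .right w)
      | .blank, .blank => some (.moveHeads (.back true) {r, r'} .left w)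
      | _, _ => some (.moveHeads (.back false) {r, r'} .left w)
    | .back b, _, w =>
      match w r with
      | .mark => none
      | _ => some (.moveHeads (.back b) {r, r'} .left w)

/-- The carry of an increment: from cell `p` on, where the digits `L` stand, ones are turned into
zeros until a zero or a blank is turned into a one. -/
theorem inc_scan {r : Fin t} (hm : m.Within s) (L : List Bool) :
    ∀ (p : ℕ) (W : ℕ → WorkSymbol), (∀ j, W (p + j) = digit L[j]?) → p + L.length < s →
      ∃ W' p', p' < s ∧ (inc r).Steps x s (CounterState.scan, m.setTape r W p)
        (CounterState.back true, m.setTape r W' p') ∧ (∀ j < p, W' j = W j) ∧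
        ∀ j, W' (p + j) = digit (succBits L)[j]? := by
  -- The last step of the scan, at a zero or a blank.
  have last : ∀ (L L' : List Bool) (p : ℕ) (W : ℕ → WorkSymbol),
      (∀ j, W (p + j) = digit L[j]?) → p + L.length < s → W p ≠ .bit true →
      (L' = true :: L.tail) →
      ∃ W' p', p' < s ∧ (inc r).Steps x s (CounterState.scan, m.setTape r W p)
        (CounterState.back true, m.setTape r W' p') ∧ (∀ j < p, W' j = W j) ∧
        ∀ j, W' (p + j) = digit L'[j]? := by
    rintro L L' p W hW hp hWp rfl
    have hlt : p - 1 < s := by omega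
    refine ⟨Function.update W p (.bit true), p - 1, hlt,
      Steps.onTape (M := inc r) (q := CounterState.scan)
          (q' := CounterState.back true) .left rfl hm hlt ?_, ?_, ?_⟩
    · intro i w hw
      rw [← hw] at hWp
      simp only [inc]
    · intro j hj
      exact Function.update_of_ne (by omega) _ _
    · rintro (_ | j)
      · simp [digit]
      · rw [Function.update_of_ne (by omega), hW]
        simp
  induction L with
  | nil =>
    intro p W hW hp
    refine last [] _ p W hW hp ?_ rfl
    have := hW 0
    simp only [add_zero] at this
    simp [this, digit]
  | cons b L ih =>
    intro p W hW hp
    have h0 := hW 0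
    cases b with
    | false => exact last (false :: L) _ p W hW hp (by simp_all [digit]) rfl
    | true =>
      have hlt : p + 1 < s := by simp at hp; omega
      obtain ⟨W', p', hp', hsteps, hbelow, habove⟩ :=
        ih (p + 1) (Function.update W p (.bit false)) (by
          intro j
          rw [Function.update_of_ne (by omega), add_assoc, add_comm 1 j, hW]
          simp) (by simp at hp; omega)
      refine ⟨W', p', hp', Relation.ReflTransGen.trans
        (Steps.onTape (M := inc r) (q := CounterState.scan)
          (q' := CounterState.scan) .right rfl hm hlt ?_) hsteps,
        ?_, ?_⟩
      · intro i w hw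
        have : w r = .bit true := by rw [hw]; simpa [digit] using h0
        simp [inc, this]
      · intro j hj
        rw [hbelow j (by omega), Function.update_of_ne (by omega)]
      · rintro (_ | j)
        · rw [add_zero, hbelow p (by omega)]
          simp [succBits, digit]
        · rw [← add_assoc, add_right_comm, habove]
          simp [succBits]

/-- The digits `L` from cell `p` on are erased. -/
theorem zero_scan {r : Fin t} (hm : m.Within s) (L : List Bool) :
    ∀ (p : ℕ) (W : ℕ → WorkSymbol), (∀ j, W (p + j) = digit L[j]?) → p + L.length < s →
      ∃ W' p', p' < s ∧ (zero r).Steps x s (CounterState.scan, m.setTape r W p)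
        (CounterState.back true, m.setTape r W' p') ∧ (∀ j < p, W' j = W j) ∧
        ∀ j, W' (p + j) = .blank := by
  induction L with
  | nil =>
    intro p W hW hp
    have hlt : p - 1 < s := by omega
    have hWp : W p = .blank := by simpa [digit] using hW 0
    refine ⟨Function.update W p .blank, p - 1, hlt,
      Steps.onTape (M := zero r) (q := CounterState.scan)
          (q' := CounterState.back true) .left rfl hm hlt ?_, ?_, ?_⟩
    · intro i w hw
      simp [zero, hw, hWp]
    · intro j hj
      exact Function.update_of_ne (by omega) _ _
    · rintro (_ | j)
      · simp
      · rw [Function.update_of_ne (by omega), hW]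
        simp [digit]
  | cons b L ih =>
    intro p W hW hp
    have h0 : W p = .bit b := by simpa [digit] using hW 0
    have hlt : p + 1 < s := by simp at hp; omega
    obtain ⟨W', p', hp', hsteps, hbelow, habove⟩ :=
      ih (p + 1) (Function.update W p .blank) (by
        intro j
        rw [Function.update_of_ne (by omega), add_assoc, add_comm 1 j, hW]
        simp) (by simp at hp; omega)
    refine ⟨W', p', hp', Relation.ReflTransGen.trans
      (Steps.onTape (M := zero r) (q := CounterState.scan)
          (q' := CounterState.scan) .right rfl hm hlt ?_) hsteps,
      ?_, ?_⟩
    · intro i w hw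
      simp [zero, hw, h0]
    · intro j hj
      rw [hbelow j (by omega), Function.update_of_ne (by omega)]
    · rintro (_ | j)
      · rw [add_zero, hbelow p (by omega)]
        simp
      · rw [← add_assoc, add_right_comm, habove]

/-- The digits on two tapes from cell `p` on are compared, with both heads moving together. -/
theorem eq_scan {r r' : Fin t} (hm : m.Within s) (L : List Bool) :
    ∀ (L' : List Bool) (p : ℕ), (∀ j, m.work r (p + j) = digit L[j]?) →
      (∀ j, m.work r' (p + j) = digit L'[j]?) → p + L.length < s →
      ∃ p' < s, (eq r r').Steps x s (CounterState.scan, m.setHeads {r, r'} p)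
        (CounterState.back (decide (L = L')), m.setHeads {r, r'} p') := by
  induction L with
  | nil =>
    intro L' p hL hL' hp
    have h : m.work r p = .blank := by simpa [digit] using hL 0
    have h' := hL' 0
    have hlt : p - 1 < s := by omega
    refine ⟨p - 1, hlt,
      Steps.moveHeads (M := eq r r') (q := CounterState.scan)
          (q' := CounterState.back (decide ([] = L'))) .left rfl hm hlt ?_⟩
    intro i w hw
    have hr := hw r (by simp)
    have hr' := hw r' (by simp)
    cases L' <;> simp_all [digit, eq]
  | cons b L ih =>
    intro L' p hL hL' hp
    have h : m.work r p = .bit b := by simpa [digit] using hL 0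
    have h' := hL' 0
    have hlt : p + 1 < s := by simp at hp; omega
    by_cases hb : L'.head? = some b
    · obtain ⟨L', rfl⟩ : ∃ M, L' = b :: M := by
        cases L' <;> simp_all
      obtain ⟨p', hp', hsteps⟩ := ih L' (p + 1)
        (fun j => by rw [add_assoc, add_comm 1 j, hL]; simp)
        (fun j => by rw [add_assoc, add_comm 1 j, hL']; simp) (by simp at hp; omega)
      have : decide (b :: L = b :: L') = decide (L = L') := by simp
      rw [this]
      refine ⟨p', hp', Relation.ReflTransGen.trans
        (Steps.moveHeads (M := eq r r') (q := CounterState.scan)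
          (q' := CounterState.scan) .right rfl hm hlt ?_) hsteps⟩
      intro i w hw
      have hr := hw r (by simp)
      have hr' := hw r' (by simp)
      cases b <;> simp_all [digit, eq]
    · have hne : decide (b :: L = L') = false := by
        cases L' <;> simp_all [eq_comm]
      rw [hne]
      have hlt : p - 1 < s := by omega
      refine ⟨p - 1, hlt,
        Steps.moveHeads (M := eq r r') (q := CounterState.scan)
          (q' := CounterState.back false) .left rfl hm hlt ?_⟩
      intro i w hw
      have hr := hw r (by simp)
      have hr' := hw r' (by simp)
      cases L' with
      | nil => cases b <;> simp_all [digit, eq]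
      | cons c L' => cases b <;> cases c <;> simp_all [digit, eq]

end Fragment

/-! ### Fragments acting on counters -/

/-- What a program works with: the position of the input head, the values of the counters and the
output so far. -/
@[ext]
structure Store (t : ℕ) where
  pos : ℕ
  reg : Fin t → ℕ
  out : List Bool

namespace Store

variable {t : ℕ}

/-- The memory that holds a store. Between two operations, all work heads are on the first cell. -/
def toMemory (σ : Store t) : Memory t where
  inputHead := σ.pos
  work := fun i => digitTape (σ.reg i).bits
  head := fun _ => 0
  output := σ.out

/-- Give counter `r` the value `v`. -/
def set (σ : Store t) (r : Fin t) (v : ℕ) : Store t := { σ with reg := Function.update σ.reg r v }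

/-- Put the input head on position `p`. -/
def moveTo (σ : Store t) (p : ℕ) : Store t := { σ with pos := p }

/-- Append `L` to the output. -/
def emit (σ : Store t) (L : List Bool) : Store t := { σ with out := σ.out ++ L }

variable (σ : Store t)

@[simp]
theorem set_reg_self (r : Fin t) (v : ℕ) : (σ.set r v).reg r = v := by
  simp [set]

theorem set_reg_of_ne {r r' : Fin t} (h : r' ≠ r) (v : ℕ) : (σ.set r v).reg r' = σ.reg r' := by
  simp [set, h]

@[simp]
theorem set_set (r : Fin t) (v w : ℕ) : (σ.set r v).set r w = σ.set r w := by
  simp [set]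

theorem set_eq_self {r : Fin t} {v : ℕ} (h : σ.reg r = v) : σ.set r v = σ := by
  subst h
  simp [set]

theorem within_toMemory (s : ℕ) [NeZero s] : σ.toMemory.Within s :=
  fun _ => Nat.pos_of_neZero s

theorem toMemory_setHeads (R : Finset (Fin t)) :
    σ.toMemory.setHeads R 0 = σ.toMemory := by
  ext <;> simp [Memory.setHeads, toMemory]

theorem toMemory_setTape (r : Fin t) (v : ℕ) :
    σ.toMemory.setTape r (digitTape v.bits) 0 = (σ.set r v).toMemory := by
  ext i j
  · rfl
  · by_cases hi : i = r
    · subst hi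
      simp [Memory.setTape, Memory.setHeads, toMemory, set]
    · simp [Memory.setTape, Memory.setHeads, toMemory, set, hi]
  · simp [Memory.setTape, Memory.setHeads, toMemory]
  · rfl

end Store

namespace Fragment

variable {t : ℕ} {x : List Bool} {s : ℕ}

/-- Run from the store `σ`, the fragment halts with the store `τ`, within space `s`. -/
def Exec (x : List Bool) (s : ℕ) (P : Fragment t) (σ τ : Store t) : Prop :=
  ∃ b, P.Runs x s σ.toMemory τ.toMemory b

/-- Run from the store `σ`, the test `T` has outcome `b` and leaves the store as it is. -/
def Test (x : List Bool) (s : ℕ) (T : Fragment t) (σ : Store t) (b : Bool) : Prop :=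
  T.Runs x s σ.toMemory σ.toMemory b

/-- The number of binary digits of `v`, together with the mark and one blank cell, fits into `s`
cells. -/
def Fits (s v : ℕ) : Prop := v.bits.length + 1 < s

end Fragment

namespace Fragment

variable {t : ℕ} {x : List Bool} {s : ℕ}

/-- Move the input head, apply `c` to all scanned work cells, possibly append a bit to the output,
and go to state `q`. -/
def _root_.MachineAction.once {Q : Type} (q : Q) (d : HeadMove) (c : WorkSymbol → WorkSymbol)
    (o : Option Bool) (w : Fin t → WorkSymbol) : MachineAction Q WorkSymbol t where
  next := q
  inputMove := d
  write := c ∘ w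
  workMove := fun _ => .stay
  emit := o

/-- Move the input head, apply `c` to all scanned work cells, and possibly append a bit to the
output. -/
def once (t : ℕ) (d : HeadMove) (c : WorkSymbol → WorkSymbol) (o : Option Bool) : Fragment t where
  State := Bool
  finiteState := inferInstance
  start := false
  result := fun _ => true
  trans
    | false, _, w => some (.once true d c o w)
    | true, _, _ => none

theorem runs_once {d : HeadMove} {c : WorkSymbol → WorkSymbol} {o : Option Bool} {m m' : Memory t}
    (hm : m.Within s) (hinput : m'.inputHead = Transducer.moveInput x m.inputHead d)
    (hwork : ∀ i, m'.work i = Function.update (m.work i) (m.head i) (c (m.work i (m.head i))))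
    (hhead : m'.head = m.head) (hout : m'.output = m.output ++ o.toList) :
    (once t d c o).Runs x s m m' true := by
  have hm' : m' = m.apply x (.once true d c o m.scanned) := by
    ext1
    · exact hinput
    · funext i
      exact hwork i
    · exact hhead
    · exact hout
  refine ⟨true, ?_, rfl, rfl⟩
  rw [hm']
  refine Steps.single (M := once t d c o) (q := false) rfl ?_
  exact hm

theorem Exec.whileDo_false {T P : Fragment t} {σ : Store t} (hT : Test x s T σ false) :
    Exec x s (T.whileDo P) σ σ :=
  ⟨_, Runs.whileDo_false hT⟩

variable [NeZero s]

/-- A counter is changed by moving right from the mark, rewriting the digits, and returning. -/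
theorem exec_of_scan {M : Fragment t} {q₁ q₂ : M.State} {σ : Store t} {r : Fin t} {v : ℕ}
    (hs : 1 < s) (h₀ : ∀ i w, M.trans M.start i w = some (.onTape q₁ r .mark .right w))
    (h₁ : ∃ W p, p < s ∧ M.Steps x s (q₁, σ.toMemory.setTape r (digitTape (σ.reg r).bits) 1)
      (q₂, σ.toMemory.setTape r W p) ∧ (∀ j < 1, W j = digitTape (σ.reg r).bits j) ∧
      ∀ j, W (1 + j) = digit v.bits[j]?)
    (h₂ : ∀ i w, w r ≠ .mark → M.trans q₂ i w = some (.moveHeads q₂ {r} .left w))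
    (h₃ : ∀ i w, w r = .mark → M.trans q₂ i w = none) : Exec x s M σ (σ.set r v) := by
  obtain ⟨W, p, hp, hsteps, hbelow, habove⟩ := h₁
  have hm := σ.within_toMemory s
  have hW : W = digitTape v.bits := by
    funext j
    cases j with
    | zero => exact hbelow 0 one_pos
    | succ j => rw [add_comm, habove, add_comm]; rfl
  subst hW
  have hstart : M.Steps x s (M.start, σ.toMemory)
      (q₁, σ.toMemory.setTape r (digitTape (σ.reg r).bits) 1) := by
    have := Steps.onTape (x := x) (W := digitTape (σ.reg r).bits) (p := 0) .right rfl hm hs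
      fun i w _ => h₀ i w
    have hmark : Function.update (digitTape (σ.reg r).bits) 0 .mark = digitTape (σ.reg r).bits :=
      Function.update_eq_self 0 _
    rw [σ.toMemory_setTape, σ.set_eq_self rfl, hmark] at this
    exact this
  have hback := Steps.moveHeads_back (x := x)
    (m := { σ.toMemory with work := Function.update σ.toMemory.work r (digitTape v.bits) })
    (Finset.mem_singleton_self r) h₂ hm (fun j => by simp [digitTape, digit_ne_mark]) hp
  refine ⟨M.result q₂, q₂, ?_, ?_, rfl⟩
  · rw [← σ.toMemory_setTape]
    exact hstart.trans (Relation.ReflTransGen.trans hsteps hback)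
  · exact h₃ _ _ (by simp [Memory.scanned, Store.toMemory, digitTape])

theorem Exec.inc {σ : Store t} {r : Fin t} (hr : Fits s (σ.reg r)) :
    Exec x s (inc r) σ (σ.set r (σ.reg r + 1)) := by
  have h := inc_scan (x := x) (r := r) (σ.within_toMemory s) (σ.reg r).bits 1
    (digitTape (σ.reg r).bits) (fun j => by rw [add_comm]; rfl) (by rw [add_comm]; exact hr)
  rw [← bits_succ] at h
  refine exec_of_scan (q₁ := CounterState.scan) (q₂ := CounterState.back true) ?_ (fun _ _ => rfl)
    h ?_ ?_
  · unfold Fits at hr; omega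
  · intro i w hw
    simp only [Fragment.inc]
  · intro i w hw
    simp [Fragment.inc, hw]

theorem Exec.zero {σ : Store t} {r : Fin t} (hr : Fits s (σ.reg r)) :
    Exec x s (zero r) σ (σ.set r 0) := by
  have h := zero_scan (x := x) (r := r) (σ.within_toMemory s) (σ.reg r).bits 1
    (digitTape (σ.reg r).bits) (fun j => by rw [add_comm]; rfl) (by rw [add_comm]; exact hr)
  refine exec_of_scan (q₁ := CounterState.scan) (q₂ := CounterState.back true) ?_ (fun _ _ => rfl)
    (by simpa [digit] using h) ?_ ?_
  · unfold Fits at hr; omega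
  · intro i w hw
    simp only [Fragment.zero]
  · intro i w hw
    simp [Fragment.zero, hw]

theorem bits_injective : Function.Injective Nat.bits := by
  intro a b h
  refine Nat.eq_of_testBit_eq fun i => ?_
  rw [Nat.testBit_eq_inth, Nat.testBit_eq_inth, h]

theorem Test.eq {σ : Store t} {r r' : Fin t} (hr : Fits s (σ.reg r)) :
    Test x s (eq r r') σ (decide (σ.reg r = σ.reg r')) := by
  unfold Fits at hr
  have hm := σ.within_toMemory s
  obtain ⟨p, hp, hsteps⟩ := eq_scan (x := x) (r := r) (r' := r') hm (σ.reg r).bits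
    (σ.reg r').bits 1 (fun j => by rw [add_comm]; rfl) (fun j => by rw [add_comm]; rfl) (by omega)
  simp only [bits_injective.eq_iff] at hsteps
  have hstart := Steps.moveHeads (x := x) (M := Fragment.eq r r') (q := CounterState.start)
    (q' := CounterState.scan) (R := {r, r'}) (p := 0) .right rfl hm (show 1 < s by omega)
    fun i w _ => rfl
  have hback := Steps.moveHeads_back (x := x) (M := Fragment.eq r r')
    (q := CounterState.back (decide (σ.reg r = σ.reg r'))) (R := {r, r'}) (r := r) (by simp)
    (fun i w hw => by simp only [Fragment.eq]) hm
    (fun j => by simp [Store.toMemory, digitTape, digit_ne_mark]) hp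
  rw [σ.toMemory_setHeads] at hstart hback
  refine ⟨_, hstart.trans (Relation.ReflTransGen.trans hsteps hback), ?_, rfl⟩
  simp [Fragment.eq, Memory.scanned, Store.toMemory, digitTape]

/-- Append `b` to the output. -/
def emit (t : ℕ) (b : Bool) : Fragment t := once t .stay id (some b)

theorem Exec.emit {σ : Store t} {b : Bool} : Exec x s (emit t b) σ (σ.emit [b]) := by
  refine ⟨true, runs_once (σ.within_toMemory s) rfl (fun i => ?_) rfl rfl⟩
  simp [Store.toMemory, Store.emit]

/-- Move the input head to the right. -/
def right (t : ℕ) : Fragment t := once t .right id none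

theorem Exec.right {σ : Store t} (h : σ.pos ≤ x.length) :
    Exec x s (right t) σ (σ.moveTo (σ.pos + 1)) := by
  refine ⟨true, runs_once (σ.within_toMemory s) ?_ (fun i => ?_) rfl ?_⟩
  · simp [Store.toMemory, Store.moveTo, Transducer.moveInput, h]
  · simp [Store.toMemory, Store.moveTo]
  · simp [Store.toMemory, Store.moveTo]

/-- Write the mark on all work tapes. -/
def setUp (t : ℕ) : Fragment t := once t .stay (fun _ => .mark) none

theorem runs_setUp :
    (setUp t).Runs x s (.initial t) (Store.toMemory ⟨0, fun _ => 0, []⟩) true := by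
  refine runs_once (fun _ => Nat.pos_of_neZero s) rfl (fun i => ?_) rfl rfl
  funext j
  cases j <;> simp [Store.toMemory, Memory.initial, digitTape, digit]

/-- Move the input head to the left end. -/
def rewind (t : ℕ) : Fragment t where
  State := Unit
  finiteState := inferInstance
  start := ()
  result := fun _ => true
  trans
    | _, .leftEnd, _ => none
    | _, _, w => some (.once () .left id none w)

theorem inputAt_succ_ne_leftEnd (p : ℕ) : Transducer.inputAt x (p + 1) ≠ .leftEnd := by
  simp only [Transducer.inputAt]
  split <;> simp

theorem Exec.rewind {σ : Store t} : Exec x s (rewind t) σ (σ.moveTo 0) := by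
  refine ⟨true, (), ?_, rfl, rfl⟩
  obtain ⟨p, reg, out⟩ := σ
  induction p with
  | zero => exact .refl
  | succ p ih =>
    refine Relation.ReflTransGen.trans ?_ ih
    set m := Store.toMemory ⟨p + 1, reg, out⟩
    have hm : m.apply x (.once () .left id none m.scanned) = Store.toMemory ⟨p, reg, out⟩ := by
      ext <;> simp [m, Memory.apply, MachineAction.once, Store.toMemory, Transducer.moveInput,
        Transducer.moveWork, Memory.scanned]
    rw [← hm]
    refine Steps.single (M := Fragment.rewind t) (q := ()) ?_ ?_
    · have := inputAt_succ_ne_leftEnd (x := x) p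
      change (Fragment.rewind t).trans () (Transducer.inputAt x (p + 1)) m.scanned = _
      simp only [Fragment.rewind]
    · exact hm ▸ Store.within_toMemory _ s

/-- Whether an input symbol is the bit `1`. -/
def _root_.InputSymbol.isOne : InputSymbol → Bool
  | .bit b => b
  | _ => false

/-- Test whether the input bit read is `1`. -/
def readsOne (t : ℕ) : Fragment t where
  State := Option Bool
  finiteState := inferInstance
  start := none
  result := fun q => q.getD false
  trans
    | none, i, w => some (.goto (some i.isOne) w)
    | some _, _, _ => none

theorem Test.readsOne {σ : Store t} :
    Test x s (readsOne t) σ (Transducer.inputAt x σ.pos).isOne := by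
  refine ⟨some (Transducer.inputAt x σ.pos).isOne, ?_, rfl, rfl⟩
  exact Steps.goto (M := Fragment.readsOne t) (q := none) (σ.within_toMemory s) rfl

theorem Exec.seq {P Q : Fragment t} {σ τ ρ : Store t} (hP : Exec x s P σ τ)
    (hQ : Exec x s Q τ ρ) : Exec x s (P.seq Q) σ ρ := by
  obtain ⟨_, hP⟩ := hP
  obtain ⟨_, hQ⟩ := hQ
  exact ⟨_, hP.seq (σ.within_toMemory s) hQ⟩

theorem Exec.cond {T P Q : Fragment t} {σ τ : Store t} {b : Bool} (hT : Test x s T σ b)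
    (hP : b = true → Exec x s P σ τ) (hQ : b = false → Exec x s Q σ τ) :
    Exec x s (T.cond P Q) σ τ := by
  have h : Exec x s (if b then P else Q) σ τ := by
    cases b
    · exact hQ rfl
    · exact hP rfl
  obtain ⟨_, h⟩ := h
  exact ⟨_, Runs.cond (σ.within_toMemory s) hT h⟩

theorem Exec.whileDo_true {T P : Fragment t} {σ τ ρ : Store t} (hT : Test x s T σ true)
    (hP : Exec x s P σ τ) (hW : Exec x s (T.whileDo P) τ ρ) : Exec x s (T.whileDo P) σ ρ := by
  obtain ⟨_, hP⟩ := hP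
  obtain ⟨_, hW⟩ := hW
  exact ⟨_, Runs.whileDo_true (σ.within_toMemory s) hT hP hW⟩

/-- Run `P` with counter `r` being `0, 1, …, n - 1`, where `n` is the value of counter `b`. Before
and after the loop, counter `r` is zero. -/
def forLoop (r b : Fin t) (P : Fragment t) : Fragment t :=
  ((eq r b).not.whileDo (P.seq (inc r))).seq (zero r)

theorem Exec.forLoop {r b : Fin t} {P : Fragment t} {n : ℕ} (hrb : b ≠ r)
    (hfit : ∀ m ≤ n, Fits s m) (τ : ℕ → Store t) (hr : ∀ m ≤ n, (τ m).reg r = 0)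
    (hb : ∀ m ≤ n, (τ m).reg b = n)
    (hP : ∀ m < n, Exec x s P ((τ m).set r m) ((τ (m + 1)).set r m)) :
    Exec x s (Fragment.forLoop r b P) (τ 0) (τ n) := by
  have htest : ∀ m ≤ n, Test x s (Fragment.eq r b).not ((τ m).set r m) (!decide (m = n)) := by
    intro m hm
    have := Test.eq (x := x) (s := s) (σ := (τ m).set r m) (r := r) (r' := b)
      (by simpa using hfit m hm)
    rw [Store.set_reg_self, Store.set_reg_of_ne _ hrb, hb m hm] at this
    exact this.not
  have hloop : ∀ d m, m + d = n → Exec x s ((Fragment.eq r b).not.whileDo (P.seq (Fragment.inc r)))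
      ((τ m).set r m) ((τ n).set r n) := by
    intro d
    induction d with
    | zero =>
      rintro m rfl
      exact Exec.whileDo_false (by simpa using htest m le_rfl)
    | succ d ih =>
      intro m hm
      have hmn : m ≠ n := by omega
      refine Exec.whileDo_true (by simpa [hmn] using htest m (by omega))
        ((hP m (by omega)).seq (Exec.inc ?_)) ?_
      · simpa using hfit m (by omega)
      · simpa using ih (m + 1) (by omega)
  have h₀ := hloop n 0 (by omega)
  rw [Store.set_eq_self _ (hr 0 (by omega))] at h₀
  have h₁ := Exec.zero (x := x) (s := s) (σ := (τ n).set r n) (r := r)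
    (by simpa using hfit n le_rfl)
  rw [Store.set_set, Store.set_eq_self _ (hr n le_rfl)] at h₁
  exact h₀.seq h₁

/-- Started with input head on the left end and counters `ρ`, the fragment appends `L` to the
output and restores everything else. -/
def Emits (x : List Bool) (s : ℕ) (P : Fragment t) (ρ : Fin t → ℕ) (L : List Bool) : Prop :=
  ∀ out, Exec x s P ⟨0, ρ, out⟩ ⟨0, ρ, out ++ L⟩

theorem Emits.emit {ρ : Fin t → ℕ} {b : Bool} : Emits x s (Fragment.emit t b) ρ [b] :=
  fun _ => Exec.emit

theorem Emits.seq {P Q : Fragment t} {ρ : Fin t → ℕ} {L L' : List Bool} (hP : Emits x s P ρ L)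
    (hQ : Emits x s Q ρ L') : Emits x s (P.seq Q) ρ (L ++ L') := by
  intro out
  refine (hP out).seq ?_
  rw [← List.append_assoc]
  exact hQ _

theorem Emits.cond_eq {P Q : Fragment t} {ρ : Fin t → ℕ} {L : List Bool} {r r' : Fin t}
    (hr : Fits s (ρ r)) (hP : ρ r = ρ r' → Emits x s P ρ L) (hQ : ρ r ≠ ρ r' → Emits x s Q ρ L) :
    Emits x s ((Fragment.eq r r').cond P Q) ρ L :=
  fun out => Exec.cond (Test.eq hr) (fun h => hP (of_decide_eq_true h) out)
    fun h => hQ (of_decide_eq_false h) out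

theorem Emits.forLoop {r b : Fin t} {P : Fragment t} {n : ℕ} (hrb : b ≠ r)
    (hfit : ∀ m ≤ n, Fits s m) {ρ : Fin t → ℕ} (hr : ρ r = 0) (hb : ρ b = n)
    (F : Fin n → List Bool) (hP : ∀ m : Fin n, Emits x s P (Function.update ρ r m) (F m)) :
    Emits x s (Fragment.forLoop r b P) ρ ((List.finRange n).flatMap F) := by
  intro out
  have := Exec.forLoop (x := x) (P := P) hrb hfit
    (fun m => ⟨0, ρ, out ++ ((List.finRange n).take m).flatMap F⟩) (fun _ _ => hr) (fun _ _ => hb)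
    fun m hm => by
      have htake : (List.finRange n).take (m + 1) = (List.finRange n).take m ++ [⟨m, hm⟩] := by
        rw [List.take_succ_eq_append_getElem (by simpa using hm)]
        simp
      simp only [htake, List.flatMap_append, List.flatMap_singleton, ← List.append_assoc]
      exact hP ⟨m, hm⟩ _
  have hall : (List.finRange n).take n = List.finRange n := List.take_of_length_le (by simp)
  simpa only [hall, List.take_zero, List.flatMap_nil, List.append_nil] using this

end Fragment

/-! ### Reading the encoded instance -/

theorem isOne_inputAt_succ (x : List Bool) (p : ℕ) :
    (Transducer.inputAt x (p + 1)).isOne = x[p]?.getD false := by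
  simp only [Transducer.inputAt]
  cases x[p]? <;> rfl

theorem getElem?_flatMap_of_length {α β : Type} {n : ℕ} (F : α → List β) (l : List α)
    (h : ∀ a ∈ l, (F a).length = n) (i j : ℕ) (hi : i < l.length) (hj : j < n) :
    (l.flatMap F)[i * n + j]? = (F l[i])[j]? := by
  induction l generalizing i with
  | nil => simp at hi
  | cons a l ih =>
    have ha : (F a).length = n := h a (by simp)
    cases i with
    | zero => rw [List.flatMap_cons, List.getElem?_append_left (by omega)]; simp
    | succ i =>
      rw [List.flatMap_cons, List.getElem?_append_right (by rw [ha]; nlinarith), ha,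
        show (i + 1) * n + j - n = i * n + j by rw [Nat.succ_mul]; omega,
        ih (fun b hb => h b (by simp [hb])) i (by simpa using hi)]
      rfl

namespace ISRInstance

variable (A : ISRInstance)

open Classical in
/-- The rows of the adjacency matrix. -/
noncomputable def matrixBits : List Bool :=
  (List.finRange A.n).flatMap fun u => (List.finRange A.n).map fun v => decide (A.graph.Adj u v)

theorem length_matrixBits : A.matrixBits.length = A.n * A.n := by
  simp [matrixBits, List.length_flatMap]

open Classical in
theorem encode_eq : A.encode = List.replicate A.n true ++ ([false] ++ (A.matrixBits ++
    ((List.finRange A.n).map (fun v => decide (v ∈ A.init)) ++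
    ((List.finRange A.n).map (fun v => decide (v ∈ A.fin)) ++ List.replicate A.k true)))) := by
  simp only [encode, matrixBits, List.append_assoc]

theorem length_encode : A.encode.length = A.n + 1 + A.n * A.n + A.n + A.n + A.k := by
  simp only [encode_eq, List.length_append, List.length_replicate, List.length_map,
    List.length_finRange, length_matrixBits, List.length_singleton]
  omega

theorem isOne_encode_of_lt {p : ℕ} (hp : p < A.n) :
    (Transducer.inputAt A.encode (p + 1)).isOne = true := by
  rw [isOne_inputAt_succ, encode_eq, List.getElem?_append_left (by simpa using hp)]
  simp [hp]

theorem isOne_encode_n : (Transducer.inputAt A.encode (A.n + 1)).isOne = false := by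
  rw [isOne_inputAt_succ, encode_eq, List.getElem?_append_right (by simp)]
  simp

open Classical in
theorem getElem?_encode (p : ℕ) (hp : A.n + 1 ≤ p) :
    A.encode[p]? = (A.matrixBits ++
      ((List.finRange A.n).map (fun v => decide (v ∈ A.init)) ++
      ((List.finRange A.n).map (fun v => decide (v ∈ A.fin)) ++
        List.replicate A.k true)))[p - (A.n + 1)]? := by
  rw [encode_eq, List.getElem?_append_right (by simp; omega),
    List.getElem?_append_right (by simp; omega)]
  simp [Nat.sub_sub]

theorem isOne_encode_adj (u v : Fin A.n) :
    (Transducer.inputAt A.encode (A.n + 2 + u * A.n + v)).isOne = true ↔ A.graph.Adj u v := by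
  have hlt : (u : ℕ) * A.n + v < A.n * A.n := by
    have := u.isLt
    have := v.isLt
    nlinarith
  rw [show A.n + 2 + u * A.n + v = (A.n + 1 + (u * A.n + v)) + 1 by omega, isOne_inputAt_succ,
    getElem?_encode _ _ (by omega), Nat.add_sub_cancel_left,
    List.getElem?_append_left (by rwa [length_matrixBits]), matrixBits,
    getElem?_flatMap_of_length (n := A.n) _ _ (by simp) _ _ (by simp) v.isLt]
  simp

theorem isOne_encode_init (v : Fin A.n) :
    (Transducer.inputAt A.encode (A.n + 2 + A.n * A.n + v)).isOne = true ↔ v ∈ A.init := by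
  rw [show A.n + 2 + A.n * A.n + v = (A.n + 1 + (A.n * A.n + v)) + 1 by omega, isOne_inputAt_succ,
    getElem?_encode _ _ (by omega), Nat.add_sub_cancel_left,
    List.getElem?_append_right (by rw [length_matrixBits]; omega), length_matrixBits,
    Nat.add_sub_cancel_left, List.getElem?_append_left (by simp)]
  simp

theorem isOne_encode_fin (v : Fin A.n) :
    (Transducer.inputAt A.encode (A.n + 2 + A.n * A.n + A.n + v)).isOne = true ↔ v ∈ A.fin := by
  rw [show A.n + 2 + A.n * A.n + A.n + v = (A.n + 1 + (A.n * A.n + (A.n + v))) + 1 by omega,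
    isOne_inputAt_succ, getElem?_encode _ _ (by omega), Nat.add_sub_cancel_left,
    List.getElem?_append_right (by rw [length_matrixBits]; omega), length_matrixBits,
    Nat.add_sub_cancel_left, List.getElem?_append_right (by simp), List.length_map,
    List.length_finRange, Nat.add_sub_cancel_left, List.getElem?_append_left (by simp)]
  simp

/-- The number of elements of the initial set among the first `m` vertices. -/
def initCount (m : ℕ) : ℕ := (A.init.filter fun v : Fin A.n => (v : ℕ) < m).card

theorem initCount_zero : A.initCount 0 = 0 := by
  simp [initCount]

theorem initCount_n : A.initCount A.n = A.k := by
  simp [initCount, A.init_card]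

theorem k_le_n : A.k ≤ A.n := by
  simpa [A.init_card] using A.init.card_le_univ

theorem initCount_le (m : ℕ) : A.initCount m ≤ A.n :=
  (Finset.card_filter_le _ _).trans (A.init_card.trans_le A.k_le_n)

theorem initCount_succ (v : Fin A.n) :
    A.initCount (v + 1) = A.initCount v + if v ∈ A.init then 1 else 0 := by
  have h : (A.init.filter fun w : Fin A.n => (w : ℕ) < v + 1) =
      (A.init.filter fun w : Fin A.n => (w : ℕ) < v) ∪
        (A.init.filter fun w : Fin A.n => w = v) := by
    ext w
    simp only [Finset.mem_filter, Finset.mem_union, Fin.ext_iff, Nat.lt_succ_iff_lt_or_eq,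
      and_or_left]
  have hd : Disjoint (A.init.filter fun w : Fin A.n => (w : ℕ) < v)
      (A.init.filter fun w : Fin A.n => w = v) := by
    rw [Finset.disjoint_filter]
    rintro w - h rfl
    exact lt_irrefl _ h
  rw [initCount, h, Finset.card_union_of_disjoint hd, Finset.filter_eq']
  split <;> rfl

/-- The element number `i` of the initial set is the one that is preceded by `i` elements. -/
theorem orderEmbOfFin_eq_iff (i : Fin A.k) (v : Fin A.n) :
    A.init.orderEmbOfFin A.init_card i = v ↔ v ∈ A.init ∧ A.initCount v = i := by
  have hcount : ∀ j, A.initCount (A.init.orderEmbOfFin A.init_card j) = j := by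
    intro j
    have h : (A.init.filter fun w : Fin A.n => (w : ℕ) < A.init.orderEmbOfFin A.init_card j) =
        (Finset.Iio j).map (A.init.orderEmbOfFin A.init_card).toEmbedding := by
      ext w
      simp only [Finset.mem_filter, Finset.mem_map, Finset.mem_Iio]
      constructor
      · rintro ⟨hw, hlt⟩
        obtain ⟨l, rfl⟩ : w ∈ Set.range (A.init.orderEmbOfFin A.init_card) := by
          rw [Finset.range_orderEmbOfFin]; exact hw
        exact ⟨l, (A.init.orderEmbOfFin A.init_card).lt_iff_lt.1 (Fin.lt_def.2 hlt), rfl⟩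
      · rintro ⟨l, hl, rfl⟩
        exact ⟨Finset.orderEmbOfFin_mem _ _ _,
          Fin.lt_def.1 ((A.init.orderEmbOfFin A.init_card).lt_iff_lt.2 hl)⟩
    rw [initCount, h, Finset.card_map, Fin.card_Iio]
  constructor
  · rintro rfl
    exact ⟨Finset.orderEmbOfFin_mem _ _ _, hcount i⟩
  · rintro ⟨hv, hi⟩
    obtain ⟨l, rfl⟩ : v ∈ Set.range (A.init.orderEmbOfFin A.init_card) := by
      rw [Finset.range_orderEmbOfFin]; exact hv
    rw [hcount] at hi
    rw [Fin.ext hi]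

end ISRInstance

/-! ### The program -/

/-- The counters of the program: `n` and `k` hold the number of vertices and of tokens, `i`, `v`
and `j`, `w` range over cliques and vertices, and `a`, `b` serve for moving the input head. -/
abbrev Counter := Fin 8

namespace Counter

abbrev n : Counter := 0
abbrev k : Counter := 1
abbrev i : Counter := 2
abbrev v : Counter := 3
abbrev j : Counter := 4
abbrev w : Counter := 5
abbrev a : Counter := 6
abbrev b : Counter := 7

end Counter

/-- The counters have the given values, and `a` and `b` are zero. -/
def counters (n k i v j w : ℕ) : Counter → ℕ := ![n, k, i, v, j, w, 0, 0]

section Update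

variable (n k i v j w m : ℕ)

@[simp] theorem counters_n : counters n k i v j w Counter.n = n := rfl
@[simp] theorem counters_v : counters n k i v j w Counter.v = v := rfl
@[simp] theorem counters_w : counters n k i v j w Counter.w = w := rfl

theorem update_counters_n :
    Function.update (counters n k i v j w) Counter.n m = counters m k i v j w := by
  ext r; fin_cases r <;> rfl

theorem update_counters_k :
    Function.update (counters n k i v j w) Counter.k m = counters n m i v j w := by
  ext r; fin_cases r <;> rfl

theorem update_counters_i :
    Function.update (counters n k i v j w) Counter.i m = counters n k m v j w := by
  ext r; fin_cases r <;> rfl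

theorem update_counters_v :
    Function.update (counters n k i v j w) Counter.v m = counters n k i m j w := by
  ext r; fin_cases r <;> rfl

theorem update_counters_j :
    Function.update (counters n k i v j w) Counter.j m = counters n k i v m w := by
  ext r; fin_cases r <;> rfl

theorem update_counters_w :
    Function.update (counters n k i v j w) Counter.w m = counters n k i v j m := by
  ext r; fin_cases r <;> rfl

end Update

namespace Fragment

/-- Move the input head to the right as many times as counter `r` says. -/
def skip (r : Counter) : Fragment 8 := forLoop Counter.a r (right 8)

/-- Move the input head across as many rows of the matrix as counter `r` says. -/
def skipRows (r : Counter) : Fragment 8 := forLoop Counter.b r (skip Counter.n)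

/-- Move the input head from the left end to the first entry of the matrix. That is position
`n + 2`: the left end marker is at position `0`, followed by the `n + 1` bits `1ⁿ0`. -/
def toMatrix : Fragment 8 := (right 8).seq ((skip Counter.n).seq (right 8))

/-- Do nothing. -/
def nop : Fragment 8 := once 8 .stay id none

/-- Read as many bits as counter `b` says and add the number of ones to counter `c`. -/
def countOnes (r b c : Counter) : Fragment 8 :=
  forLoop r b (((readsOne 8).cond (inc c) nop).seq (right 8))

/-- Append the outcome of a test. -/
def emitTest (T : Fragment 8) : Fragment 8 := T.cond (emit 8 true) (emit 8 false)

/-- Append the entry of the adjacency matrix for the vertices `v` and `w`. -/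
def emitAdj : Fragment 8 :=
  toMatrix.seq ((skipRows Counter.v).seq ((skip Counter.w).seq
    ((emitTest (readsOne 8)).seq (rewind 8))))

/-- Append whether vertex `r` is outside the final set. -/
def emitNotFin (r : Counter) : Fragment 8 :=
  toMatrix.seq ((skipRows Counter.n).seq ((skip Counter.n).seq ((skip r).seq
    ((emitTest (readsOne 8).not).seq (rewind 8)))))

/-- Append whether vertex `v` is element number `i` of the initial set: the ones before its bit in
the characteristic vector are counted in `j`, and the input head ends on that bit. -/
def emitInit : Fragment 8 :=
  toMatrix.seq ((skipRows Counter.n).seq ((countOnes Counter.w Counter.v Counter.j).seq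
    (((readsOne 8).cond (emitTest (eq Counter.i Counter.j)) (emit 8 false)).seq
      ((zero Counter.j).seq (rewind 8)))))

/-- For all vertices of the copy graph, in their order, do what the four given fragments say for
the four kinds of vertices. Counter `r` runs through the cliques, counter `q` through the vertices
of the given graph. -/
def forVertices (r q : Counter) (P Pf Pi Pz : Fragment 8) : Fragment 8 :=
  (forLoop r Counter.k ((forLoop q Counter.n P).seq Pf)).seq (Pi.seq Pz)

/-- Compute the number of vertices, which is given in unary, and the number of tokens, which is the
number of ones in the characteristic vector of the initial set. -/
def computeSizes : Fragment 8 :=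
  (right 8).seq (((readsOne 8).whileDo ((inc Counter.n).seq (right 8))).seq ((rewind 8).seq
    (toMatrix.seq ((skipRows Counter.n).seq
      ((countOnes Counter.v Counter.n Counter.k).seq (rewind 8))))))

/-- Append the encoding of the constructed instance. -/
def emitInstance : Fragment 8 :=
  (forVertices Counter.i Counter.v (emit 8 true) (emit 8 true) (emit 8 true) (emit 8 true)).seq <|
  (emit 8 false).seq <|
  (forVertices Counter.i Counter.v
    (forVertices Counter.j Counter.w
      ((eq Counter.i Counter.j).cond (emitTest (eq Counter.v Counter.w).not)
        ((eq Counter.v Counter.w).cond (emit 8 true) emitAdj))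
      (emitTest (eq Counter.i Counter.j)) (emit 8 false) (emitNotFin Counter.v))
    (forVertices Counter.j Counter.w (emitTest (eq Counter.i Counter.j)) (emit 8 false)
      (emit 8 true) (emit 8 false))
    (forVertices Counter.j Counter.w (emit 8 false) (emit 8 true) (emit 8 false) (emit 8 true))
    (forVertices Counter.j Counter.w (emitNotFin Counter.w) (emit 8 false) (emit 8 true)
      (emit 8 false))).seq <|
  (forVertices Counter.i Counter.v emitInit (emit 8 false) (emit 8 true) (emit 8 false)).seq <|
  (forVertices Counter.i Counter.v (emit 8 false) (emit 8 true) (emit 8 false) (emit 8 true)).seq <|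
  (forLoop Counter.i Counter.k (emit 8 true)).seq (emit 8 true)

/-! ### Correctness of the program -/

variable {x : List Bool} {s : ℕ} [NeZero s]

theorem Exec.skip {r : Counter} (hr : r ≠ Counter.a) {p : ℕ} {ρ : Counter → ℕ} {out : List Bool}
    (hfit : ∀ m ≤ ρ r, Fits s m) (ha : ρ Counter.a = 0) (hp : p + ρ r ≤ x.length + 1) :
    Exec x s (skip r) ⟨p, ρ, out⟩ ⟨p + ρ r, ρ, out⟩ := by
  have := Exec.forLoop (x := x) (P := Fragment.right 8) hr hfit (fun m => ⟨p + m, ρ, out⟩)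
    (fun _ _ => ha) (fun _ _ => rfl) fun m hm =>
      Exec.right (σ := ⟨p + m, Function.update ρ Counter.a m, out⟩) (by simp only; omega)
  exact this

theorem Exec.skipRows {r : Counter} (hr : r ≠ Counter.b) {p : ℕ} {ρ : Counter → ℕ} {out : List Bool}
    (hfit : ∀ m ≤ ρ r, Fits s m) (hfit' : ∀ m ≤ ρ Counter.n, Fits s m)
    (ha : ρ Counter.a = 0) (hb : ρ Counter.b = 0) (hp : p + ρ r * ρ Counter.n ≤ x.length + 1) :
    Exec x s (skipRows r) ⟨p, ρ, out⟩ ⟨p + ρ r * ρ Counter.n, ρ, out⟩ := by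
  have := Exec.forLoop (x := x) (P := Fragment.skip Counter.n) hr hfit
    (fun m => ⟨p + m * ρ Counter.n, ρ, out⟩) (fun _ _ => hb) (fun _ _ => rfl) fun m hm => by
      have hle : (m + 1) * ρ Counter.n ≤ ρ r * ρ Counter.n := Nat.mul_le_mul_right _ hm
      have hn : Function.update ρ Counter.b m Counter.n = ρ Counter.n :=
        Function.update_of_ne (by decide) _ _
      have := Exec.skip (x := x) (s := s) (r := Counter.n) (by decide) (p := p + m * ρ Counter.n)
        (ρ := Function.update ρ Counter.b m) (out := out) (by rwa [hn])
        (by rw [Function.update_of_ne (by decide)]; exact ha)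
        (by rw [hn]; rw [Nat.succ_mul] at hle; omega)
      rw [hn, add_assoc, ← Nat.succ_mul] at this
      exact this
  simp only [Nat.zero_mul, add_zero] at this
  exact this

theorem Exec.toMatrix {ρ : Counter → ℕ} {out : List Bool} (hfit : ∀ m ≤ ρ Counter.n, Fits s m)
    (ha : ρ Counter.a = 0) (hp : ρ Counter.n + 1 ≤ x.length) :
    Exec x s toMatrix ⟨0, ρ, out⟩ ⟨ρ Counter.n + 2, ρ, out⟩ := by
  refine (Exec.right (σ := ⟨0, ρ, out⟩) (Nat.zero_le _)).seq (Exec.seq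
    (Exec.skip (r := Counter.n) (p := 1) (by decide) hfit ha
      (by change 1 + ρ Counter.n ≤ _; omega)) ?_)
  rw [add_comm 1]
  exact Exec.right (σ := ⟨ρ Counter.n + 1, ρ, out⟩) hp

theorem Exec.nop {σ : Store 8} : Exec x s nop σ σ := by
  refine ⟨true, runs_once (σ.within_toMemory s) rfl (fun i => ?_) rfl ?_⟩ <;>
    simp [Store.toMemory]

theorem Exec.countOnes {r b c : Counter} (hb : b ≠ r) (hbc : b ≠ c) (hrc : r ≠ c) {p : ℕ}
    {ρ : Counter → ℕ} {out : List Bool} (hr : ρ r = 0) (hfit : ∀ m ≤ ρ b, Fits s m) (g : ℕ → ℕ)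
    (hgfit : ∀ m, Fits s (g m)) (hg₀ : g 0 = ρ c)
    (hg : ∀ m < ρ b,
      g (m + 1) = g m + if (Transducer.inputAt x (p + m)).isOne then 1 else 0)
    (hp : p + ρ b ≤ x.length + 1) :
    Exec x s (countOnes r b c) ⟨p, ρ, out⟩ ⟨p + ρ b, Function.update ρ c (g (ρ b)), out⟩ := by
  have := Exec.forLoop (x := x) (P := ((Fragment.readsOne 8).cond (Fragment.inc c)
      Fragment.nop).seq (Fragment.right 8)) hb hfit
    (fun m => ⟨p + m, Function.update ρ c (g m), out⟩)
    (fun _ _ => by simp only; rwa [Function.update_of_ne hrc])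
    (fun _ _ => by simp only [Function.update_of_ne hbc]) fun m hm => by
      refine Exec.seq (τ := Store.set ⟨p + m, Function.update ρ c (g (m + 1)), out⟩ r m)
        (Exec.cond Test.readsOne (fun h => ?_) fun h => ?_)
        (Exec.right (by simp only [Store.set]; omega))
      · have hinc := Exec.inc (x := x) (s := s) (r := c)
          (σ := Store.set ⟨p + m, Function.update ρ c (g m), out⟩ r m)
          (by rw [Store.set_reg_of_ne _ hrc.symm]; simpa using hgfit m)
        rw [Store.set_reg_of_ne _ hrc.symm] at hinc
        simp only [Store.set] at h hinc ⊢
        rw [Function.update_comm hrc, Function.update_self, Function.update_idem] at hinc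
        rw [hg m hm, if_pos h]
        exact hinc
      · simp only [Store.set] at h ⊢
        rw [hg m hm, if_neg (by simp [h])]
        exact Exec.nop
  simp only [add_zero, hg₀, Function.update_eq_self] at this
  exact this

theorem Exec.emitTest {T : Fragment 8} {p : ℕ} {ρ : Counter → ℕ} {out : List Bool} {b : Bool}
    (hT : Test x s T ⟨p, ρ, out⟩ b) :
    Exec x s (emitTest T) ⟨p, ρ, out⟩ ⟨p, ρ, out ++ [b]⟩ := by
  refine Exec.cond hT ?_ ?_ <;> rintro rfl
  · exact Exec.emit
  · exact Exec.emit

theorem Exec.emitTest_readsOne {p : ℕ} {ρ : Counter → ℕ} {out : List Bool} {b : Bool}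
    (h : (Transducer.inputAt x p).isOne = b) :
    Exec x s (Fragment.emitTest (readsOne 8)) ⟨p, ρ, out⟩ ⟨p, ρ, out ++ [b]⟩ :=
  h ▸ Exec.emitTest Test.readsOne

theorem Exec.emitTest_readsOne_not {p : ℕ} {ρ : Counter → ℕ} {out : List Bool} {b : Bool}
    (h : (Transducer.inputAt x p).isOne = !b) :
    Exec x s (Fragment.emitTest (readsOne 8).not) ⟨p, ρ, out⟩ ⟨p, ρ, out ++ [b]⟩ := by
  have := Exec.emitTest (x := x) (s := s) (ρ := ρ) (out := out)
    (Runs.not (Test.readsOne (σ := ⟨p, ρ, out⟩)))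
  simp only [h, Bool.not_not] at this
  exact this

theorem Emits.emitTest_eq {ρ : Counter → ℕ} {r r' : Counter} (hr : Fits s (ρ r)) :
    Emits x s (Fragment.emitTest (Fragment.eq r r')) ρ [decide (ρ r = ρ r')] :=
  fun _ => Exec.emitTest (Test.eq hr)

theorem Emits.emitTest_ne {ρ : Counter → ℕ} {r r' : Counter} (hr : Fits s (ρ r)) :
    Emits x s (Fragment.emitTest (Fragment.eq r r').not) ρ [!decide (ρ r = ρ r')] :=
  fun _ => Exec.emitTest (Runs.not (Test.eq hr))

end Fragment

/-- The space used on an instance with `n` vertices: no counter ever exceeds `n`. -/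
def workSpace (n : ℕ) : ℕ := n.bits.length + 2

instance (n : ℕ) : NeZero (workSpace n) := ⟨by simp [workSpace]⟩

theorem fits_workSpace {m n : ℕ} (h : m ≤ n) : Fragment.Fits (workSpace n) m := by
  have := Nat.size_le_size h
  rw [← Nat.size_eq_bits_len, ← Nat.size_eq_bits_len] at this
  simp only [Fragment.Fits, workSpace]
  omega

namespace ISRInstance

open Fragment

variable (A : ISRInstance)

/-- The counters once the sizes of the instance are known. -/
def state (i v j w : ℕ) : Counter → ℕ := counters A.n A.k i v j w

theorem exec_toMatrix {k i v j w : ℕ} {out : List Bool} :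
    Exec A.encode (workSpace A.n) toMatrix ⟨0, counters A.n k i v j w, out⟩
      ⟨A.n + 2, counters A.n k i v j w, out⟩ :=
  Exec.toMatrix (fun _ => fits_workSpace) rfl (by rw [length_encode]; simp only [counters_n]; omega)

/-- The input head moves to the characteristic vector of the initial set. -/
theorem exec_toInit {k i v j w : ℕ} {out : List Bool} :
    Exec A.encode (workSpace A.n) (skipRows Counter.n) ⟨A.n + 2, counters A.n k i v j w, out⟩
      ⟨A.n + 2 + A.n * A.n, counters A.n k i v j w, out⟩ :=
  Exec.skipRows (by decide) (fun _ => fits_workSpace) (fun _ => fits_workSpace) rfl rfl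
    (by rw [length_encode]; simp only [counters_n]; omega)

theorem emits_emitAdj (i j : ℕ) (v w : Fin A.n) [Decidable (A.graph.Adj v w)] :
    Emits A.encode (workSpace A.n) emitAdj (A.state i v j w) [decide (A.graph.Adj v w)] := by
  intro out
  have hv := v.isLt
  have hw := w.isLt
  have hvw : ((v : ℕ) + 1) * A.n ≤ A.n * A.n := Nat.mul_le_mul_right _ hv
  rw [Nat.succ_mul] at hvw
  refine A.exec_toMatrix.seq (Exec.seq (Exec.skipRows (by decide) ?_ (fun _ => fits_workSpace) rfl
    rfl ?_) (Exec.seq (Exec.skip (by decide) ?_ rfl ?_) (Exec.seq (Exec.emitTest_readsOne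
      ?_) Exec.rewind)))
  · exact fun m hm => fits_workSpace (hm.trans hv.le)
  · rw [length_encode]; simp only [counters_n, counters_v]; omega
  · exact fun m hm => fits_workSpace (hm.trans hw.le)
  · rw [length_encode]; simp only [counters_n, counters_v, counters_w]; omega
  · rw [Bool.eq_iff_iff, decide_eq_true_iff]
    exact A.isOne_encode_adj v w

theorem emits_emitNotFin {r : Counter} (hr : r ≠ Counter.a) {i v j w : ℕ} (u : Fin A.n)
    (hu : A.state i v j w r = u) :
    Emits A.encode (workSpace A.n) (emitNotFin r) (A.state i v j w) [decide (u ∉ A.fin)] := by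
  intro out
  have hlt := u.isLt
  refine A.exec_toMatrix.seq (A.exec_toInit.seq (Exec.seq (Exec.skip (r := Counter.n) (by decide)
    (fun _ => fits_workSpace) rfl ?_) (Exec.seq (Exec.skip hr ?_ rfl ?_)
      (Exec.seq (Exec.emitTest_readsOne_not ?_) Exec.rewind))))
  · rw [length_encode]; simp only [counters_n]; omega
  · exact fun m hm => fits_workSpace (hm.trans (hu.trans_le hlt.le))
  · change _ + A.state i v j w r ≤ _
    rw [length_encode, hu]; simp only [counters_n]; omega
  · change (Transducer.inputAt A.encode (A.n + 2 + A.n * A.n + A.n + A.state i v j w r)).isOne = _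
    rw [hu, Bool.eq_iff_iff, isOne_encode_fin]
    simp

theorem exec_countOnes_init {r b c : Counter} (hb : b ≠ r) (hbc : b ≠ c) (hrc : r ≠ c)
    {ρ : Counter → ℕ} {out : List Bool} (hr : ρ r = 0) (hc : ρ c = 0) (hn : ρ b ≤ A.n) :
    Exec A.encode (workSpace A.n) (countOnes r b c) ⟨A.n + 2 + A.n * A.n, ρ, out⟩
      ⟨A.n + 2 + A.n * A.n + ρ b, Function.update ρ c (A.initCount (ρ b)), out⟩ := by
  refine Exec.countOnes hb hbc hrc hr (fun m hm => fits_workSpace (hm.trans hn)) A.initCount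
    (fun m => fits_workSpace (A.initCount_le m)) (by rw [initCount_zero, hc]) ?_ ?_
  · intro m hm
    have := A.isOne_encode_init ⟨m, hm.trans_le hn⟩
    simp only at this
    rw [A.initCount_succ ⟨m, hm.trans_le hn⟩]
    simp only [this]
  · rw [length_encode]; omega

theorem emits_emitInit (i : Fin A.k) (v : Fin A.n)
    [Decidable (A.init.orderEmbOfFin A.init_card i = v)] :
    Emits A.encode (workSpace A.n) emitInit (A.state i v 0 0)
      [decide (A.init.orderEmbOfFin A.init_card i = v)] := by
  intro out
  have hfit : Fits (workSpace A.n) (A.initCount v) := fits_workSpace (A.initCount_le _)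
  have hi : Fits (workSpace A.n) i := fits_workSpace (i.isLt.le.trans A.k_le_n)
  have hcount := A.exec_countOnes_init (r := Counter.w) (b := Counter.v) (c := Counter.j)
    (by decide) (by decide) (by decide) (ρ := A.state i v 0 0) (out := out) rfl rfl v.isLt.le
  simp only [state, counters_v, update_counters_j] at hcount
  refine A.exec_toMatrix.seq (A.exec_toInit.seq (hcount.seq (Exec.seq
    (τ := ⟨A.n + 2 + A.n * A.n + v, A.state i v (A.initCount v) 0,
      out ++ [decide (A.init.orderEmbOfFin A.init_card i = v)]⟩) ?_ (Exec.seq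
      (τ := ⟨A.n + 2 + A.n * A.n + v, A.state i v 0 0,
        out ++ [decide (A.init.orderEmbOfFin A.init_card i = v)]⟩) ?_ Exec.rewind))))
  · have hiff := A.orderEmbOfFin_eq_iff i v
    refine Exec.cond Test.readsOne (fun h => ?_) fun h => ?_
    · replace h := (A.isOne_encode_init v).1 h
      have := Exec.emitTest (x := A.encode) (s := workSpace A.n)
        (T := Fragment.eq Counter.i Counter.j) (p := A.n + 2 + A.n * A.n + v)
        (ρ := A.state i v (A.initCount v) 0) (out := out)
        (Test.eq hi)
      rw [show decide (A.init.orderEmbOfFin A.init_card i = v) =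
          decide ((i : ℕ) = A.initCount v) from
        decide_eq_decide.2 (hiff.trans ⟨fun h' => h'.2.symm, fun h' => ⟨h, h'.symm⟩⟩)]
      exact this
    · have h' : v ∉ A.init := fun hv => by
        rw [(A.isOne_encode_init v).2 hv] at h
        simp at h
      have : decide (A.init.orderEmbOfFin A.init_card i = v) = false := by simp [hiff, h']
      rw [this]
      exact Exec.emit
  · have := Exec.zero (x := A.encode) (s := workSpace A.n) (r := Counter.j)
      (σ := ⟨A.n + 2 + A.n * A.n + v, A.state i v (A.initCount v) 0,
        out ++ [decide (A.init.orderEmbOfFin A.init_card i = v)]⟩) hfit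
    simp only [Store.set, state, update_counters_j] at this
    exact this

theorem exec_computeSizes :
    Exec A.encode (workSpace A.n) computeSizes ⟨0, fun _ => 0, []⟩ ⟨0, A.state 0 0 0 0, []⟩ := by
  have hzero : (fun _ => 0 : Counter → ℕ) = counters 0 0 0 0 0 0 := by
    ext r; fin_cases r <;> rfl
  have hloop : ∀ d m, m + d = A.n → Exec A.encode (workSpace A.n)
      ((readsOne 8).whileDo ((inc Counter.n).seq (right 8))) ⟨m + 1, counters m 0 0 0 0 0, []⟩
      ⟨A.n + 1, counters A.n 0 0 0 0 0, []⟩ := by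
    intro d
    induction d with
    | zero =>
      rintro m rfl
      refine Exec.whileDo_false ?_
      have := Test.readsOne (x := A.encode) (s := workSpace A.n)
        (σ := ⟨A.n + 1, counters A.n 0 0 0 0 0, []⟩)
      rwa [isOne_encode_n] at this
    | succ d ih =>
      intro m hm
      have htest := Test.readsOne (x := A.encode) (s := workSpace A.n)
        (σ := ⟨m + 1, counters m 0 0 0 0 0, []⟩)
      rw [A.isOne_encode_of_lt (by omega)] at htest
      have hinc := Exec.inc (x := A.encode) (s := workSpace A.n) (r := Counter.n)
        (σ := ⟨m + 1, counters m 0 0 0 0 0, []⟩) (fits_workSpace (show m ≤ A.n by omega))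
      simp only [Store.set, counters_n, update_counters_n] at hinc
      exact Exec.whileDo_true htest
        (hinc.seq (Exec.right (by rw [length_encode]; simp only; omega))) (ih (m + 1) (by omega))
  have hcount := A.exec_countOnes_init (r := Counter.v) (b := Counter.n) (c := Counter.k)
    (by decide) (by decide) (by decide) (ρ := counters A.n 0 0 0 0 0) (out := []) rfl rfl le_rfl
  simp only [counters_n, update_counters_k, initCount_n] at hcount
  rw [hzero]
  exact Exec.seq (Exec.right (Nat.zero_le _)) ((hloop A.n 0 (by omega)).seq (Exec.rewind.seq
    (A.exec_toMatrix.seq (A.exec_toInit.seq (hcount.seq Exec.rewind)))))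

end ISRInstance

namespace ISRInstance

open Fragment

variable (A : ISRInstance)

theorem emits_forVertices {r q : Counter} {P Pf Pi Pz : Fragment 8} {ρ : Counter → ℕ}
    (hn : ρ Counter.n = A.n) (hk : ρ Counter.k = A.k) (hr : ρ r = 0) (hq : ρ q = 0)
    (hkr : Counter.k ≠ r) (hnr : Counter.n ≠ r) (hnq : Counter.n ≠ q) (hqr : q ≠ r)
    (F : CopyVertex (Fin A.n) A.k → List Bool)
    (hP : ∀ (i : Fin A.k) (v : Fin A.n), Emits A.encode (workSpace A.n) P
      (Function.update (Function.update ρ r i) q v) (F (copy i v)))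
    (hf : ∀ i : Fin A.k, Emits A.encode (workSpace A.n) Pf (Function.update ρ r i) (F (f i)))
    (hi : Emits A.encode (workSpace A.n) Pi ρ (F zInit))
    (hz : Emits A.encode (workSpace A.n) Pz ρ (F zFin)) :
    Emits A.encode (workSpace A.n) (forVertices r q P Pf Pi Pz) ρ
      ((copyVertices A.n A.k).flatMap F) := by
  rw [flatMap_copyVertices]
  refine (Emits.forLoop hkr (fun m hm => fits_workSpace (hm.trans A.k_le_n)) hr hk _
    fun i => ?_).seq (hi.seq hz)
  refine (Emits.forLoop hnq (fun m => fits_workSpace) ?_ ?_ _ (hP i)).seq (hf i)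
  · rwa [Function.update_of_ne hqr]
  · rwa [Function.update_of_ne hnr]

theorem emits_forVertices_iv {P Pf Pi Pz : Fragment 8}
    (F : CopyVertex (Fin A.n) A.k → List Bool)
    (hP : ∀ (i : Fin A.k) (v : Fin A.n),
      Emits A.encode (workSpace A.n) P (A.state i v 0 0) (F (copy i v)))
    (hf : ∀ i : Fin A.k, Emits A.encode (workSpace A.n) Pf (A.state i 0 0 0) (F (f i)))
    (hi : Emits A.encode (workSpace A.n) Pi (A.state 0 0 0 0) (F zInit))
    (hz : Emits A.encode (workSpace A.n) Pz (A.state 0 0 0 0) (F zFin)) :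
    Emits A.encode (workSpace A.n) (forVertices Counter.i Counter.v P Pf Pi Pz) (A.state 0 0 0 0)
      ((copyVertices A.n A.k).flatMap F) := by
  refine A.emits_forVertices rfl rfl rfl rfl (by decide) (by decide) (by decide) (by decide) F
    (fun i v => ?_) (fun i => ?_) hi hz
  · rw [state, update_counters_i, update_counters_v]
    exact hP i v
  · rw [state, update_counters_i]
    exact hf i

theorem emits_forVertices_jw {P Pf Pi Pz : Fragment 8} {i v : ℕ}
    (F : CopyVertex (Fin A.n) A.k → Bool)
    (hP : ∀ (j : Fin A.k) (w : Fin A.n),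
      Emits A.encode (workSpace A.n) P (A.state i v j w) [F (copy j w)])
    (hf : ∀ j : Fin A.k, Emits A.encode (workSpace A.n) Pf (A.state i v j 0) [F (f j)])
    (hi : Emits A.encode (workSpace A.n) Pi (A.state i v 0 0) [F zInit])
    (hz : Emits A.encode (workSpace A.n) Pz (A.state i v 0 0) [F zFin]) :
    Emits A.encode (workSpace A.n) (forVertices Counter.j Counter.w P Pf Pi Pz) (A.state i v 0 0)
      ((copyVertices A.n A.k).map F) := by
  rw [List.map_eq_flatMap]
  refine A.emits_forVertices rfl rfl rfl rfl (by decide) (by decide) (by decide) (by decide) _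
    (fun j w => ?_) (fun j => ?_) hi hz
  · rw [state, update_counters_j, update_counters_w]
    exact hP j w
  · rw [state, update_counters_j]
    exact hf j

theorem emits_emit_of_iff {p : Prop} [Decidable p] {b : Bool} (h : p ↔ b = true)
    (ρ : Counter → ℕ) : Emits A.encode (workSpace A.n) (emit 8 b) ρ [decide p] := by
  have : decide p = b := by rw [Bool.eq_iff_iff, decide_eq_true_iff, h]
  rw [this]
  exact Emits.emit

theorem emits_emitTest_eq_of_iff {p : Prop} [Decidable p] {i v j w : ℕ} (hi : i ≤ A.n)
    (h : p ↔ i = j) : Emits A.encode (workSpace A.n) (emitTest (eq Counter.i Counter.j))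
      (A.state i v j w) [decide p] := by
  have := Emits.emitTest_eq (x := A.encode) (s := workSpace A.n) (ρ := A.state i v j w)
    (r := Counter.i) (r' := Counter.j) (fits_workSpace hi)
  have hp : decide p = decide (i = j) := decide_eq_decide.2 h
  rw [hp]
  exact this

open Classical in
theorem emits_row_copy (i : Fin A.k) (v : Fin A.n) :
    Emits A.encode (workSpace A.n)
      (forVertices Counter.j Counter.w
        ((eq Counter.i Counter.j).cond (emitTest (eq Counter.v Counter.w).not)
          ((eq Counter.v Counter.w).cond (emit 8 true) emitAdj))
        (emitTest (eq Counter.i Counter.j)) (emit 8 false) (emitNotFin Counter.v))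
      (A.state i v 0 0)
      ((copyVertices A.n A.k).map fun w => decide (A.copyGraph.Adj (copy i v) w)) := by
  have hi := i.isLt.le.trans A.k_le_n
  have hv : Fits (workSpace A.n) (v : ℕ) := fits_workSpace v.isLt.le
  refine A.emits_forVertices_jw _ (fun j w => ?_) (fun j => ?_) ?_ ?_
  · refine Emits.cond_eq (fits_workSpace hi) (fun hij => ?_) fun hij => ?_
    · obtain rfl : i = j := Fin.ext hij
      have := Emits.emitTest_ne (x := A.encode) (s := workSpace A.n) (ρ := A.state i v i w)
        (r := Counter.v) (r' := Counter.w) hv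
      convert this using 2
      rw [← decide_not]
      refine decide_eq_decide.2 ?_
      simp [copyGraph_adj_iff, copyRel, state, Fin.ext_iff]
    · have hne : i ≠ j := fun h => hij (by rw [h]; rfl)
      refine Emits.cond_eq hv (fun hvw => ?_) fun hvw => ?_
      · obtain rfl : v = w := Fin.ext hvw
        exact A.emits_emit_of_iff (by simp [copyGraph_adj_iff, copyRel, hne]) _
      · have hvw : v ≠ w := fun h => hvw (by rw [h]; rfl)
        have hadj : A.copyGraph.Adj (copy i v) (copy j w) ↔ A.graph.Adj v w := by
          simp [copyGraph_adj_iff, copyRel, hne, hne.symm, hvw, hvw.symm, A.graph.adj_comm w v]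
        simp only [hadj]
        exact A.emits_emitAdj i j v w
  · exact A.emits_emitTest_eq_of_iff hi
      (by simp [copyGraph_adj_iff, copyRel, Fin.ext_iff, eq_comm])
  · exact A.emits_emit_of_iff (by simp [copyGraph_adj_iff, copyRel]) _
  · have hadj : A.copyGraph.Adj (copy i v) zFin ↔ v ∉ A.fin := by
      simp [copyGraph_adj_iff, copyRel]
    simp only [hadj]
    convert A.emits_emitNotFin (r := Counter.v) (by decide) v rfl

open Classical in
theorem emits_row_f (i : Fin A.k) :
    Emits A.encode (workSpace A.n)
      (forVertices Counter.j Counter.w (emitTest (eq Counter.i Counter.j)) (emit 8 false)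
        (emit 8 true) (emit 8 false))
      (A.state i 0 0 0)
      ((copyVertices A.n A.k).map fun w => decide (A.copyGraph.Adj (f i) w)) := by
  have hi := i.isLt.le.trans A.k_le_n
  refine A.emits_forVertices_jw _ (fun j w => ?_) (fun j => ?_) ?_ ?_
  · exact A.emits_emitTest_eq_of_iff hi (by simp [copyGraph_adj_iff, copyRel, Fin.ext_iff])
  all_goals exact A.emits_emit_of_iff (by simp [copyGraph_adj_iff, copyRel]) _

open Classical in
theorem emits_row_zInit :
    Emits A.encode (workSpace A.n)
      (forVertices Counter.j Counter.w (emit 8 false) (emit 8 true) (emit 8 false) (emit 8 true))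
      (A.state 0 0 0 0)
      ((copyVertices A.n A.k).map fun w => decide (A.copyGraph.Adj zInit w)) := by
  refine A.emits_forVertices_jw _ (fun j w => ?_) (fun j => ?_) ?_ ?_
  all_goals exact A.emits_emit_of_iff (by simp [copyGraph_adj_iff, copyRel]) _

open Classical in
theorem emits_row_zFin :
    Emits A.encode (workSpace A.n)
      (forVertices Counter.j Counter.w (emitNotFin Counter.w) (emit 8 false) (emit 8 true)
        (emit 8 false))
      (A.state 0 0 0 0)
      ((copyVertices A.n A.k).map fun w => decide (A.copyGraph.Adj zFin w)) := by
  refine A.emits_forVertices_jw _ (fun j w => ?_) (fun j => ?_) ?_ ?_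
  · have hadj : A.copyGraph.Adj zFin (copy j w) ↔ w ∉ A.fin := by
      simp [copyGraph_adj_iff, copyRel]
    simp only [hadj]
    convert A.emits_emitNotFin (r := Counter.w) (by decide) w rfl
  all_goals exact A.emits_emit_of_iff (by simp [copyGraph_adj_iff, copyRel]) _

/-- The output is the encoding of the constructed instance. -/
theorem emits_emitInstance :
    Emits A.encode (workSpace A.n) emitInstance (A.state 0 0 0 0) A.copyInstance.encode := by
  classical
  have hones : ∀ m, List.replicate m true = (List.finRange m).flatMap fun _ => [true] := by
    intro m
    rw [← List.map_eq_flatMap, List.map_const', List.length_finRange]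
  have hlen : List.replicate (copyVertices A.n A.k).length true =
      (copyVertices A.n A.k).flatMap fun _ => [true] := by
    rw [← List.map_eq_flatMap, List.map_const']
  rw [encode_copyInstance, hlen, List.replicate_succ', hones, List.map_eq_flatMap,
    List.map_eq_flatMap]
  simp only [List.append_assoc]
  refine (A.emits_forVertices_iv _ (fun _ _ => Emits.emit) (fun _ => Emits.emit) Emits.emit
    Emits.emit).seq (Emits.emit.seq (Emits.seq ?_ (Emits.seq ?_ (Emits.seq ?_ (Emits.seq
      (Emits.forLoop (by decide) (fun m hm => fits_workSpace (hm.trans A.k_le_n)) rfl rfl _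
        fun _ => Emits.emit) Emits.emit)))))
  · exact A.emits_forVertices_iv _ A.emits_row_copy A.emits_row_f A.emits_row_zInit
      A.emits_row_zFin
  · refine A.emits_forVertices_iv _ (fun i v => ?_) (fun i => ?_) ?_ ?_
    · have hmem : copy i v ∈ A.copyInit ↔ A.init.orderEmbOfFin A.init_card i = v := by
        simp [copyInit]
      simp only [hmem]
      exact A.emits_emitInit i v
    all_goals exact A.emits_emit_of_iff (by simp [copyInit]) _
  · refine A.emits_forVertices_iv _ (fun i v => ?_) (fun i => ?_) ?_ ?_
    all_goals exact A.emits_emit_of_iff (by simp [copyFin]) _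

/-- The machine that computes the encoding of `A.copyInstance` from that of `A`. -/
def copyMachine : Transducer := ((setUp 8).seq (computeSizes.seq emitInstance)).toTransducer

/-- Logarithmic space suffices, without a contribution of the parameter, because `k ≤ n`. -/
theorem computesInSpace_copyMachine :
    copyMachine.ComputesInSpace A.encode A.copyInstance.encode
      (1 * (3 + Nat.log 2 A.encode.length)) := by
  obtain ⟨b, hrun⟩ := A.exec_computeSizes.seq (A.emits_emitInstance [])
  have h := (Runs.seq (fun _ => Nat.pos_of_neZero (workSpace A.n)) runs_setUp hrun).computesInSpace
    (Nat.pos_of_neZero _)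
  refine ⟨h.1, fun c hc i => (h.2 c hc i).trans_le ?_⟩
  have hn : A.n < 2 ^ (Nat.log 2 A.encode.length + 1) :=
    lt_trans (by rw [length_encode]; omega) (Nat.lt_pow_succ_log_self one_lt_two _)
  rw [workSpace, Nat.size_eq_bits_len]
  have := Nat.size_le.2 hn
  omega

end ISRInstance

theorem mainTheorem2 :
    ∃ f : ISRInstance → ISRInstance,
      IsPLReduction TJIndependentSetReconfiguration TSIndependentSetReconfiguration f ∧
      ∀ A : ISRInstance,
        A.IsCopyInstance (f A) ∧
        (∀ l : ℕ, (∃ m ≤ l, A.HasTJSequence m) ↔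
          ∃ m ≤ l + A.k + 1, (f A).HasTSSequence m) ∧
        (∀ l : ℕ, A.HasTJSequence l → (f A).HasTSSequence (l + A.k + 1)) := by
  have hseq := fun A : ISRInstance =>
    ISRInstance.exists_hasTSSequence_le_iff A.isCopyInstance_copyInstance
  refine ⟨ISRInstance.copyInstance, ⟨fun A => ⟨?_, ?_⟩, ?_, ?_⟩, fun A =>
    ⟨A.isCopyInstance_copyInstance, hseq A⟩⟩
  · rintro ⟨l, h⟩
    exact ⟨_, (hseq A).2 l h⟩
  · rintro ⟨l, h⟩
    obtain ⟨m, -, hm⟩ := ((hseq A).1 l).2 ⟨l, by omega, h⟩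
    exact ⟨m, hm⟩
  · exact ⟨Nat.succ, Primrec.succ.to_comp, fun A => le_rfl⟩
  · exact ⟨ISRInstance.copyMachine, fun _ => 3, 1, Computable.const 3,
      fun A => A.computesInSpace_copyMachine⟩
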